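/- Let $\Bbbk$ be $\mathbb R$ or $\mathbb C$, let $h\in\Bbbk$, $h\neq0$, let $k\in\{\tfrac12,1,\tfrac32,\dots\}$, $l=2k$, and let $q\in\Bbbk$, $q\ne 0$, be generic in the sense that $q^{2n}\neq1$ for $1\le n\le 2l+2$ (for instance, $q$ is not a root of unity). Let $U_q(sl(2))$ be the algebra generated by $H,X,Y,q^{\pm H}$ with $[H,X]=2X$, $[H,Y]=-2Y$, $[X,Y]=\frac{q^H-q^{-H}}{q-q^{-1}}$ (and the resulting commutation rules $q^HX=q^2Xq^H$, $Yq^H=q^2q^HY$, $Hq^H=q^HH$), coproduct $\Delta(X)=X\otimes1+q^{-H}\otimes X$, $\Delta(Y)=1\otimes Y+Y\otimes q^H$, $\Delta(H)=H\otimes1+1\otimes H$, $\Delta(q^{\pm H})=q^{\pm H}\otimes q^{\pm H}$, and antipode $\gamma(X)=-q^HX$, $\gamma(H)=-H$, $\gamma(Y)=-Yq^{-H}$, $\gamma(q^{\pm H})=q^{\mp H}$. Let $V$ be the $U_q(sl(2))$-module with basis $u,v,w$ and $Hu=2u$, $Hv=0$, $Hw=-2w$, $q^Hu=q^2u$, $q^Hv=v$,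 $q^Hw=q^{-2}w$, $Xu=0$, $Xv=-(q+q^{-1})u$, $Xw=v$, $Yu=-v$, $Yv=(q+q^{-1})w$, $Yw=0$. A $U_q(sl(2))$-module is called irreducible of spin $k$ if it is irreducible and contains a vector $x\ne0$ with $Xx=0$, $Hx=lx$, $q^Hx=q^lx$. For a $U_q(sl(2))$-module $(U,\rho)$ let $U_q(sl(2))$ act on $\mathrm{End}(U)$ by $a\cdot M=\rho(a_1)M\rho(\gamma(a_2))$, where $\Delta(a)=a_1\otimes a_2$ in Sweedler's notation. A linear map $f:V\to\mathrm{End}(U)$ is called an almost representation of the q-Lie algebra $\overline{sl(2)}$ with factor $\nu\in\Bbbk$, $\nu\neq0$, if it is a $U_q(sl(2))$-morphism and $$q^2f(u)f(v)-f(v)f(u)=-2h\nu f(u),$$ $$(q^3+q)\bigl(f(u)f(w)-f(w)f(u)\bigr)+(1-q^2)f(v)^2=2h\nu f(v),$$ $$-q^2f(v)f(w)+f(w)f(v)=2h\nu f(w),$$ and a representation if this holds with $\nu=1$. Let $A_{h,q}$ be the quotient of the tensor algebra $T(V)$ by the ideal generated by $q^2uv-vu+2hu$, $(q^3+q)(uw-wu)+(1-q^2)v^2-2hv$,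 $-q^2vw+wv-2hw$. Then an irreducible module of spin $k$ exists, on a space of dimension $l+1$. For every irreducible module $U_k$ of spin $k$ there is exactly one submodule $W$ of $\mathrm{End}(U_k)$ isomorphic to $V$, and every $U_q(sl(2))$-morphism $\overline\rho:V\to\mathrm{End}(U_k)$ with image $W$ is an almost representation of $\overline{sl(2)}$. For any of its factors $\nu$, the map $\nu^{-1}\overline\rho$ is a representation of $\overline{sl(2)}$, and it extends to a unique algebra homomorphism $A_{h,q}\to\mathrm{End}(U_k)$. -/

import Mathlib

/-! Representations of an associative algebra as algebra homomorphisms into `Module.End`. -/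

namespace QSl2

open scoped TensorProduct

section Rep

variable {𝕜 A M N : Type*} [Field 𝕜] [Ring A] [Algebra 𝕜 A]
  [AddCommGroup M] [Module 𝕜 M] [AddCommGroup N] [Module 𝕜 N]

/-- `f` is a morphism from the `A`-module `(M, σ)` to the `A`-module `(N, τ)`. -/
def Intertwines (σ : A →ₐ[𝕜] Module.End 𝕜 M) (τ : A →ₐ[𝕜] Module.End 𝕜 N)
    (f : M →ₗ[𝕜] N) : Prop :=
  ∀ (a : A) (x : M), f (σ a x) = τ a (f x)

/-- The `A`-module `(M, σ)` is irreducible: nonzero, and its only invariant subspaces are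
`0` and `M`. -/
def IsIrreducible (σ : A →ₐ[𝕜] Module.End 𝕜 M) : Prop :=
  Nontrivial M ∧ ∀ W : Submodule 𝕜 M, (∀ (a : A), ∀ x ∈ W, σ a x ∈ W) → W = ⊥ ∨ W = ⊤

/-- `W` is an `A`-submodule of `(N, τ)` isomorphic to the `A`-module `(M, σ)`, that is, the image
of an injective morphism. -/
def IsCopy (σ : A →ₐ[𝕜] Module.End 𝕜 M) (τ : A →ₐ[𝕜] Module.End 𝕜 N)
    (W : Submodule 𝕜 N) : Prop :=
  ∃ f : M →ₗ[𝕜] N, Intertwines σ τ f ∧ Function.Injective f ∧ LinearMap.range f = W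

end Rep

/-! The quantum group `U_q(sl(2))`. -/

/-- Generators; `K` and `Ki` stand for `q^H` and `q^{-H}`. -/
inductive Gen : Type
  | H | X | Y | K | Ki

section Quantum

variable {𝕜 : Type*} [Field 𝕜]

/-- Generators in the free algebra. -/
abbrev g (𝕜 : Type*) [Field 𝕜] (x : Gen) : FreeAlgebra 𝕜 Gen := FreeAlgebra.ι 𝕜 x

/-- Defining relations. The commutation relations of `q^H` with `H`, `X`, `Y` are the
consequences of `[H, X] = 2 X`, `[H, Y] = -2 Y` for the exponential `q^H`. -/
inductive Rel (q : 𝕜) : FreeAlgebra 𝕜 Gen → FreeAlgebra 𝕜 Gen → Prop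
  | K_Ki : Rel q (g 𝕜 .K * g 𝕜 .Ki) 1
  | Ki_K : Rel q (g 𝕜 .Ki * g 𝕜 .K) 1
  | H_K : Rel q (g 𝕜 .H * g 𝕜 .K) (g 𝕜 .K * g 𝕜 .H)
  | K_X : Rel q (g 𝕜 .K * g 𝕜 .X) (q ^ 2 • (g 𝕜 .X * g 𝕜 .K))
  | Y_K : Rel q (g 𝕜 .Y * g 𝕜 .K) (q ^ 2 • (g 𝕜 .K * g 𝕜 .Y))
  | H_X : Rel q (g 𝕜 .H * g 𝕜 .X - g 𝕜 .X * g 𝕜 .H) ((2 : 𝕜) • g 𝕜 .X)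
  | H_Y : Rel q (g 𝕜 .H * g 𝕜 .Y - g 𝕜 .Y * g 𝕜 .H) ((-2 : 𝕜) • g 𝕜 .Y)
  | X_Y : Rel q (g 𝕜 .X * g 𝕜 .Y - g 𝕜 .Y * g 𝕜 .X) ((q - q⁻¹)⁻¹ • (g 𝕜 .K - g 𝕜 .Ki))

/-- The algebra `U_q(sl(2))`. -/
def Uq (q : 𝕜) : Type _ := RingQuot (Rel q)

instance (q : 𝕜) : Ring (Uq q) := inferInstanceAs (Ring (RingQuot (Rel q)))

instance (q : 𝕜) : Algebra 𝕜 (Uq q) := inferInstanceAs (Algebra 𝕜 (RingQuot (Rel q)))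

/-- The projection from the free algebra. -/
def mk (q : 𝕜) : FreeAlgebra 𝕜 Gen →ₐ[𝕜] Uq q := RingQuot.mkAlgHom 𝕜 (Rel q)

theorem mk_rel {q : 𝕜} {x y : FreeAlgebra 𝕜 Gen} (hxy : Rel q x y) : mk q x = mk q y :=
  RingQuot.mkAlgHom_rel 𝕜 hxy

/-- The images of the generators in `U_q(sl(2))`. -/
def gen (q : 𝕜) (x : Gen) : Uq q := mk q (FreeAlgebra.ι 𝕜 x)

/-- Five elements of an algebra satisfy the defining relations of `U_q(sl(2))`. -/
structure Satisfies {B : Type*} [Ring B] [Algebra 𝕜 B] (q : 𝕜) (f : Gen → B) : Prop where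
  K_Ki : f .K * f .Ki = 1
  Ki_K : f .Ki * f .K = 1
  H_K : f .H * f .K = f .K * f .H
  K_X : f .K * f .X = q ^ 2 • (f .X * f .K)
  Y_K : f .Y * f .K = q ^ 2 • (f .K * f .Y)
  H_X : f .H * f .X - f .X * f .H = (2 : 𝕜) • f .X
  H_Y : f .H * f .Y - f .Y * f .H = (-2 : 𝕜) • f .Y
  X_Y : f .X * f .Y - f .Y * f .X = (q - q⁻¹)⁻¹ • (f .K - f .Ki)

theorem satisfies_gen (q : 𝕜) : Satisfies q (gen q) where
  K_Ki := by simpa [gen] using mk_rel (Rel.K_Ki (q := q))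
  Ki_K := by simpa [gen] using mk_rel (Rel.Ki_K (q := q))
  H_K := by simpa [gen] using mk_rel (Rel.H_K (q := q))
  K_X := by simpa only [gen, map_mul, map_smul] using mk_rel (Rel.K_X (q := q))
  Y_K := by simpa only [gen, map_mul, map_smul] using mk_rel (Rel.Y_K (q := q))
  H_X := by
    simpa only [gen, map_mul, map_sub, map_smul] using
      mk_rel (Rel.H_X (q := q))
  H_Y := by
    simpa only [gen, map_mul, map_sub, map_smul] using
      mk_rel (Rel.H_Y (q := q))
  X_Y := by
    simpa only [gen, map_mul, map_sub, map_smul] using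
      mk_rel (Rel.X_Y (q := q))

/-- The algebra homomorphism out of `U_q(sl(2))` with prescribed values on generators. -/
def lift {B : Type*} [Ring B] [Algebra 𝕜 B] (q : 𝕜) (f : Gen → B) (hf : Satisfies q f) :
    Uq q →ₐ[𝕜] B :=
  RingQuot.liftAlgHom 𝕜 ⟨FreeAlgebra.lift 𝕜 f, by
    intro x y hxy
    cases hxy <;> simp only [map_mul, map_sub, map_smul, map_one, FreeAlgebra.lift_ι_apply]
    · exact hf.K_Ki
    · exact hf.Ki_K
    · exact hf.H_K
    · exact hf.K_X
    · exact hf.Y_K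
    · exact hf.H_X
    · exact hf.H_Y
    · exact hf.X_Y⟩

theorem lift_gen {B : Type*} [Ring B] [Algebra 𝕜 B] (q : 𝕜) (f : Gen → B)
    (hf : Satisfies q f) (x : Gen) : lift q f hf (gen q x) = f x := by
  have e : lift q f hf (mk q (FreeAlgebra.ι 𝕜 x)) = FreeAlgebra.lift 𝕜 f (FreeAlgebra.ι 𝕜 x) :=
    RingQuot.liftAlgHom_mkAlgHom_apply 𝕜 _ _ _
  rw [gen, e, FreeAlgebra.lift_ι_apply]

/-- Values of the coproduct on generators:
`Δ(X) = X ⊗ 1 + q^{-H} ⊗ X`, `Δ(Y) = 1 ⊗ Y + Y ⊗ q^H`, `Δ(H) = H ⊗ 1 + 1 ⊗ H`. -/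
def comulGen (q : 𝕜) : Gen → Uq q ⊗[𝕜] Uq q
  | .H => gen q .H ⊗ₜ 1 + 1 ⊗ₜ gen q .H
  | .X => gen q .X ⊗ₜ 1 + gen q .Ki ⊗ₜ gen q .X
  | .Y => 1 ⊗ₜ gen q .Y + gen q .Y ⊗ₜ gen q .K
  | .K => gen q .K ⊗ₜ gen q .K
  | .Ki => gen q .Ki ⊗ₜ gen q .Ki

/-- Values of the antipode on generators: `γ(X) = -q^H X`, `γ(H) = -H`, `γ(Y) = -Y q^{-H}`. -/
def antipodeGen (q : 𝕜) : Gen → (Uq q)ᵐᵒᵖ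
  | .H => .op (-gen q .H)
  | .X => .op (-(gen q .K * gen q .X))
  | .Y => .op (-(gen q .Y * gen q .Ki))
  | .K => .op (gen q .Ki)
  | .Ki => .op (gen q .K)

theorem H_Ki (q : 𝕜) : gen q .H * gen q .Ki = gen q .Ki * gen q .H := by
  have s := satisfies_gen q
  calc gen q .H * gen q .Ki = gen q .Ki * (gen q .K * gen q .H) * gen q .Ki := by
        rw [← mul_assoc, s.Ki_K, one_mul]
    _ = gen q .Ki * gen q .H := by
        rw [← s.H_K, mul_assoc, mul_assoc, s.K_Ki, mul_one]

theorem Ki_Y (q : 𝕜) : gen q .Ki * gen q .Y = q ^ 2 • (gen q .Y * gen q .Ki) := by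
  have s := satisfies_gen q
  calc gen q .Ki * gen q .Y = gen q .Ki * (gen q .Y * gen q .K) * gen q .Ki := by
        rw [mul_assoc, mul_assoc, s.K_Ki, mul_one]
    _ = q ^ 2 • (gen q .Y * gen q .Ki) := by
        rw [s.Y_K, mul_smul_comm, ← mul_assoc, s.Ki_K, one_mul, smul_mul_assoc]

theorem X_Ki (q : 𝕜) : gen q .X * gen q .Ki = q ^ 2 • (gen q .Ki * gen q .X) := by
  have s := satisfies_gen q
  calc gen q .X * gen q .Ki = gen q .Ki * (gen q .K * gen q .X) * gen q .Ki := by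
        rw [← mul_assoc, s.Ki_K, one_mul]
    _ = q ^ 2 • (gen q .Ki * gen q .X) := by
        rw [s.K_X, mul_smul_comm, smul_mul_assoc, mul_assoc, mul_assoc, s.K_Ki, mul_one]

theorem satisfies_comulGen (q : 𝕜) : Satisfies q (comulGen q) := by
  have s := satisfies_gen q
  constructor
  · simp [comulGen, s.K_Ki, Algebra.TensorProduct.one_def]
  · simp [comulGen, s.Ki_K, Algebra.TensorProduct.one_def]
  · simp [comulGen, mul_add, add_mul, s.H_K]
  · simp only [comulGen, mul_add, add_mul, Algebra.TensorProduct.tmul_mul_tmul, one_mul, mul_one,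
      s.K_X, s.K_Ki, s.Ki_K, TensorProduct.smul_tmul', TensorProduct.tmul_smul, smul_add]
  · simp only [comulGen, mul_add, add_mul, Algebra.TensorProduct.tmul_mul_tmul, one_mul, mul_one,
      s.Y_K, TensorProduct.smul_tmul', TensorProduct.tmul_smul, smul_add]
  · have e : gen q .H * gen q .X = (2 : 𝕜) • gen q .X + gen q .X * gen q .H :=
      sub_eq_iff_eq_add.mp s.H_X
    simp only [comulGen, mul_add, add_mul, Algebra.TensorProduct.tmul_mul_tmul, one_mul, mul_one,
      e, H_Ki, TensorProduct.add_tmul, TensorProduct.tmul_add, TensorProduct.smul_tmul',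
      TensorProduct.tmul_smul, smul_add]
    abel
  · have e : gen q .H * gen q .Y = (-2 : 𝕜) • gen q .Y + gen q .Y * gen q .H :=
      sub_eq_iff_eq_add.mp s.H_Y
    simp only [comulGen, mul_add, add_mul, Algebra.TensorProduct.tmul_mul_tmul, one_mul, mul_one,
      e, s.H_K, TensorProduct.add_tmul, TensorProduct.tmul_add, TensorProduct.smul_tmul',
      TensorProduct.tmul_smul, smul_add]
    abel
  · have e : gen q .X * gen q .Y = (q - q⁻¹)⁻¹ • (gen q .K - gen q .Ki) + gen q .Y * gen q .X :=
      sub_eq_iff_eq_add.mp s.X_Y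
    simp only [comulGen, mul_add, add_mul, Algebra.TensorProduct.tmul_mul_tmul, one_mul, mul_one,
      e, s.K_X, Ki_Y, TensorProduct.add_tmul, TensorProduct.tmul_add, TensorProduct.sub_tmul,
      TensorProduct.tmul_sub, TensorProduct.smul_tmul', TensorProduct.tmul_smul, smul_sub]
    abel

theorem satisfies_antipodeGen (q : 𝕜) : Satisfies q (antipodeGen q) := by
  have s := satisfies_gen q
  constructor <;> apply MulOpposite.unop_injective <;>
    simp only [antipodeGen, MulOpposite.unop_mul, MulOpposite.unop_op, MulOpposite.unop_smul,
      MulOpposite.unop_sub, MulOpposite.unop_one, neg_mul, mul_neg, neg_neg, smul_neg]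
  · exact s.K_Ki
  · exact s.Ki_K
  · rw [H_Ki]
  · rw [mul_assoc, X_Ki, mul_smul_comm, ← mul_assoc, s.K_Ki, ← mul_assoc, s.Ki_K]
  · rw [← mul_assoc, Ki_Y, smul_mul_assoc]
  · rw [← mul_assoc, s.H_K, mul_assoc, mul_assoc, ← mul_sub, ← neg_sub, s.H_X, mul_neg,
      mul_smul_comm]
  · rw [mul_assoc, ← H_Ki, ← mul_assoc, ← mul_assoc, ← sub_mul, ← neg_sub, s.H_Y, neg_mul,
      smul_mul_assoc]
  · have e1 : gen q .Y * gen q .Ki * (gen q .K * gen q .X) = gen q .Y * gen q .X := by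
      rw [mul_assoc, ← mul_assoc (gen q .Ki), s.Ki_K, one_mul]
    have e2 : gen q .K * gen q .X * (gen q .Y * gen q .Ki) = gen q .X * gen q .Y := by
      rw [s.K_X, smul_mul_assoc, ← mul_smul_comm, ← Ki_Y, mul_assoc, ← mul_assoc (gen q .K),
        s.K_Ki, one_mul]
    rw [e1, e2, ← neg_sub, s.X_Y, ← smul_neg, neg_sub]

/-- The coproduct of `U_q(sl(2))`. -/
noncomputable def comul (q : 𝕜) : Uq q →ₐ[𝕜] Uq q ⊗[𝕜] Uq q :=
  lift q (comulGen q) (satisfies_comulGen q)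

/-- The antipode of `U_q(sl(2))`, an anti-homomorphism. -/
noncomputable def antipode (q : 𝕜) : Uq q →ₐ[𝕜] (Uq q)ᵐᵒᵖ :=
  lift q (antipodeGen q) (satisfies_antipodeGen q)

/-- The action on `End(U)`: `ρ_End(a) M = ρ(a₁) ∘ M ∘ ρ(γ(a₂))`, where `Δ(a) = a₁ ⊗ a₂`. -/
noncomputable def endRep {q : 𝕜} {U : Type*} [AddCommGroup U] [Module 𝕜 U]
    (ρ : Uq q →ₐ[𝕜] Module.End 𝕜 U) : Uq q →ₐ[𝕜] Module.End 𝕜 (Module.End 𝕜 U) :=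
  (AlgHom.mulLeftRight 𝕜 (Module.End 𝕜 U)).comp
    ((Algebra.TensorProduct.map ρ ((AlgHom.op ρ).comp (antipode q))).comp (comul q))

/-- `(U, ρ)` is an irreducible module of spin `l / 2`: it is irreducible, with a highest weight
vector of weight `l`, on which `q^H` acts as `q ^ l`. -/
def IsSpin (q : 𝕜) (l : ℕ) {U : Type*} [AddCommGroup U] [Module 𝕜 U]
    (ρ : Uq q →ₐ[𝕜] Module.End 𝕜 U) : Prop :=
  IsIrreducible ρ ∧ ∃ x : U, x ≠ 0 ∧ ρ (gen q .X) x = 0 ∧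
    ρ (gen q .H) x = (l : 𝕜) • x ∧ ρ (gen q .K) x = q ^ l • x

/-! The module `V` and the algebra `A_{h,q}`. -/

/-- The space `V`, of dimension three. -/
abbrev V (𝕜 : Type*) : Type _ := Fin 3 → 𝕜

/-- Basis vector `u`. -/
def u (𝕜 : Type*) [Field 𝕜] : V 𝕜 := ![1, 0, 0]

/-- Basis vector `v`. -/
def v (𝕜 : Type*) [Field 𝕜] : V 𝕜 := ![0, 1, 0]

/-- Basis vector `w`. -/
def w (𝕜 : Type*) [Field 𝕜] : V 𝕜 := ![0, 0, 1]

/-- The matrices of the generators on `V` in the basis `u, v, w`: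
`Hu = 2u, Hv = 0, Hw = -2w, Xu = 0, Xv = -(q + q⁻¹)u, Xw = v, Yu = -v, Yv = (q + q⁻¹)w, Yw = 0`. -/
def vMat (q : 𝕜) : Gen → Matrix (Fin 3) (Fin 3) 𝕜
  | .H => !![2, 0, 0; 0, 0, 0; 0, 0, -2]
  | .X => !![0, -(q + q⁻¹), 0; 0, 0, 1; 0, 0, 0]
  | .Y => !![0, 0, 0; -1, 0, 0; 0, q + q⁻¹, 0]
  | .K => !![q ^ 2, 0, 0; 0, 1, 0; 0, 0, (q ^ 2)⁻¹]
  | .Ki => !![(q ^ 2)⁻¹, 0, 0; 0, 1, 0; 0, 0, q ^ 2]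

theorem satisfies_vMat (q : 𝕜) (h0 : q ≠ 0) (h1 : q ^ 2 ≠ 1) : Satisfies q (vMat q) := by
  have h2 : q ^ 2 - 1 ≠ 0 := sub_ne_zero.mpr h1
  have h3 : q - q⁻¹ ≠ 0 := by
    intro h
    apply h2
    have h' : q * (q - q⁻¹) = 0 := by rw [h, mul_zero]
    rwa [mul_sub, mul_inv_cancel₀ h0, ← pow_two] at h'
  have h4 : (q - q⁻¹)⁻¹ * (q ^ 2 - (q ^ 2)⁻¹) = q + q⁻¹ := by
    rw [inv_mul_eq_iff_eq_mul₀ h3]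
    field_simp
    ring
  have h5 : (q - q⁻¹)⁻¹ * ((q ^ 2)⁻¹ - q ^ 2) = -(q + q⁻¹) := by
    rw [← h4]
    ring
  constructor <;> ext i j <;> fin_cases i <;> fin_cases j <;>
    simp [vMat, Matrix.mul_apply, Fin.sum_univ_three, h0, h4, h5] <;> ring

/-- The `U_q(sl(2))`-module `V`. -/
noncomputable def vRep (q : 𝕜) (h0 : q ≠ 0) (h1 : q ^ 2 ≠ 1) :
    Uq q →ₐ[𝕜] Module.End 𝕜 (V 𝕜) :=
  (Matrix.toLinAlgEquiv' : Matrix (Fin 3) (Fin 3) 𝕜 ≃ₐ[𝕜] _).toAlgHom.comp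
    (lift q (vMat q) (satisfies_vMat q h0 h1))

/-- Three elements `a, b, c` (the images of `u, v, w`) of an algebra satisfy the defining relations
of the q-Lie algebra up to the factor `ν`. -/
def Relations {B : Type*} [Ring B] [Algebra 𝕜 B] (q h ν : 𝕜) (a b c : B) : Prop :=
  q ^ 2 • (a * b) - b * a = ν • (-2 * h) • a ∧
  (q ^ 3 + q) • (a * c - c * a) + (1 - q ^ 2) • (b * b) = ν • (2 * h) • b ∧
  -(q ^ 2) • (b * c) + c * b = ν • (2 * h) • c

/-- `f : V → End(U)` is an almost representation of the q-Lie algebra with factor `ν`. -/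
def IsAlmostRepWith {q : 𝕜} (h0 : q ≠ 0) (h1 : q ^ 2 ≠ 1) (h ν : 𝕜)
    {U : Type*} [AddCommGroup U] [Module 𝕜 U] (ρ : Uq q →ₐ[𝕜] Module.End 𝕜 U)
    (f : V 𝕜 →ₗ[𝕜] Module.End 𝕜 U) : Prop :=
  Intertwines (vRep q h0 h1) (endRep ρ) f ∧ ν ≠ 0 ∧ Relations q h ν (f (u 𝕜)) (f (v 𝕜)) (f (w 𝕜))

/-- `f : V → End(U)` is an almost representation of the q-Lie algebra. -/
def IsAlmostRep {q : 𝕜} (h0 : q ≠ 0) (h1 : q ^ 2 ≠ 1) (h : 𝕜)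
    {U : Type*} [AddCommGroup U] [Module 𝕜 U] (ρ : Uq q →ₐ[𝕜] Module.End 𝕜 U)
    (f : V 𝕜 →ₗ[𝕜] Module.End 𝕜 U) : Prop :=
  ∃ ν : 𝕜, IsAlmostRepWith h0 h1 h ν ρ f

/-- `f : V → End(U)` is a representation of the q-Lie algebra: the factor is `1`. -/
def IsRep {q : 𝕜} (h0 : q ≠ 0) (h1 : q ^ 2 ≠ 1) (h : 𝕜)
    {U : Type*} [AddCommGroup U] [Module 𝕜 U] (ρ : Uq q →ₐ[𝕜] Module.End 𝕜 U)
    (f : V 𝕜 →ₗ[𝕜] Module.End 𝕜 U) : Prop :=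
  IsAlmostRepWith h0 h1 h 1 ρ f

/-- Basis elements of `V` in the tensor algebra `T(V)`. -/
abbrev t (x : V 𝕜) : TensorAlgebra 𝕜 (V 𝕜) := TensorAlgebra.ι 𝕜 x

/-- Defining relations of `A_{h,q}`. -/
inductive ARel (h q : 𝕜) : TensorAlgebra 𝕜 (V 𝕜) → TensorAlgebra 𝕜 (V 𝕜) → Prop
  | uv : ARel h q (q ^ 2 • (t (u 𝕜) * t (v 𝕜)) - t (v 𝕜) * t (u 𝕜)) ((-2 * h) • t (u 𝕜))
  | uw : ARel h q ((q ^ 3 + q) • (t (u 𝕜) * t (w 𝕜) - t (w 𝕜) * t (u 𝕜))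
      + (1 - q ^ 2) • (t (v 𝕜) * t (v 𝕜))) ((2 * h) • t (v 𝕜))
  | vw : ARel h q (-(q ^ 2) • (t (v 𝕜) * t (w 𝕜)) + t (w 𝕜) * t (v 𝕜)) ((2 * h) • t (w 𝕜))

/-- The enveloping algebra `A_{h,q}` of the q-Lie algebra. -/
def Ahq (h q : 𝕜) : Type _ := RingQuot (ARel h q)

noncomputable instance (h q : 𝕜) : Ring (Ahq h q) := inferInstanceAs (Ring (RingQuot (ARel h q)))

noncomputable instance (h q : 𝕜) : Algebra 𝕜 (Ahq h q) :=
  inferInstanceAs (Algebra 𝕜 (RingQuot (ARel h q)))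

/-- The projection from the tensor algebra. -/
noncomputable def mkA (h q : 𝕜) : TensorAlgebra 𝕜 (V 𝕜) →ₐ[𝕜] Ahq h q :=
  RingQuot.mkAlgHom 𝕜 (ARel h q)

/-- The canonical map `V → A_{h,q}`. -/
noncomputable def ιA (h q : 𝕜) : V 𝕜 →ₗ[𝕜] Ahq h q :=
  (mkA h q).toLinearMap ∘ₗ TensorAlgebra.ι 𝕜

end Quantum

end QSl2

namespace QSl2

open scoped TensorProduct

variable {𝕜 : Type*} [Field 𝕜]

/-! The Casimir element `YX + (q - q⁻¹)⁻²(qK + q⁻¹K⁻¹)` acts on an irreducible module of spin `l /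
2` as a scalar `c`. Hence `XY - q²YX`, in which the terms in `K⁻¹` cancel, acts as an affine
function of `K`. The assignment `u ↦ KX`, `v ↦ XY - q²YX`, `w ↦ Y` is then a morphism `V → End(U)`
(`intertwines_stdMor`), and since `X` and `Y` commute with `K` up to powers of `q`, its values
satisfy the q-Lie relations with `2hν = (q² - 1)²c` (`relations_image`). Genericity gives `c ≠ 0`
(`casimir_ne_zero`), so `ν ≠ 0`.

Every other morphism is a multiple of this one (`IsLadder.exists_eq_smul_stdMor`). A morphism is
determined by the image `m` of `u`; `m` raises weights by 2 and satisfies `Xm = q⁻²mX`, so it is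
determined by its value on the lowest weight vector, which lies in a one-dimensional weight space.
This gives the uniqueness of `W`. The relations are quadratic on the left and linear on the right,
so scaling a morphism scales its factor, and division by the factor gives a representation.

The structure of `U`, with no assumption on its dimension, comes from the ladder `Yⁱx` below the
highest weight vector: irreducibility forces it to span `U` and to stop after index `l`. The same
coefficients define the module that proves existence. -/

theorem Uq.induction {q : 𝕜} {P : Uq q → Prop} (h_alg : ∀ r : 𝕜, P (algebraMap 𝕜 _ r))
    (h_gen : ∀ x, P (gen q x)) (h_mul : ∀ a b, P a → P b → P (a * b))
    (h_add : ∀ a b, P a → P b → P (a + b)) (a : Uq q) : P a := by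
  obtain ⟨a, rfl⟩ := RingQuot.mkAlgHom_surjective 𝕜 (Rel q) a
  induction a using FreeAlgebra.induction with
  | grade0 r => rw [AlgHom.commutes]; exact h_alg r
  | grade1 x => exact h_gen x
  | mul a b ha hb => rw [map_mul]; exact h_mul _ _ ha hb
  | add a b ha hb => rw [map_add]; exact h_add _ _ ha hb

/-! ### Reduction to generators and the explicit action on endomorphisms -/

section Modules

variable {q : 𝕜} {M N : Type*} [AddCommGroup M] [Module 𝕜 M] [AddCommGroup N] [Module 𝕜 N]

theorem intertwines_of_gen {σ : Uq q →ₐ[𝕜] Module.End 𝕜 M} {τ : Uq q →ₐ[𝕜] Module.End 𝕜 N}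
    {f : M →ₗ[𝕜] N} (hf : ∀ g x, f (σ (gen q g) x) = τ (gen q g) (f x)) :
    Intertwines σ τ f := by
  intro a
  induction a using Uq.induction with
  | h_alg r => intro x; simp [Module.algebraMap_end_apply]
  | h_gen g => exact hf g
  | h_mul a b ha hb => intro x; simp [ha, hb]
  | h_add a b ha hb => intro x; simp [ha, hb]

theorem invariant_of_gen {σ : Uq q →ₐ[𝕜] Module.End 𝕜 M} {W : Submodule 𝕜 M}
    (hW : ∀ g, ∀ x ∈ W, σ (gen q g) x ∈ W) (a : Uq q) : ∀ x ∈ W, σ a x ∈ W := by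
  induction a using Uq.induction with
  | h_alg r => intro x hx; simpa [Module.algebraMap_end_apply] using W.smul_mem r hx
  | h_gen g => exact hW g
  | h_mul a b ha hb => intro x hx; simpa using ha _ (hb x hx)
  | h_add a b ha hb => intro x hx; simpa using W.add_mem (ha x hx) (hb x hx)

theorem Intertwines.smul {A : Type*} [Ring A] [Algebra 𝕜 A] {σ : A →ₐ[𝕜] Module.End 𝕜 M}
    {τ : A →ₐ[𝕜] Module.End 𝕜 N} {f : M →ₗ[𝕜] N} (hf : Intertwines σ τ f) (s : 𝕜) :
    Intertwines σ τ (s • f) := by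
  intro a x
  simp [hf a x]

theorem Satisfies.map {B C : Type*} [Ring B] [Algebra 𝕜 B] [Ring C] [Algebra 𝕜 C]
    {F : Gen → B} (s : Satisfies q F) (φ : B →ₐ[𝕜] C) : Satisfies q (fun x ↦ φ (F x)) where
  K_Ki := by rw [← map_mul, s.K_Ki, map_one]
  Ki_K := by rw [← map_mul, s.Ki_K, map_one]
  H_K := by rw [← map_mul, s.H_K, map_mul]
  K_X := by rw [← map_mul, s.K_X, map_smul, map_mul]
  Y_K := by rw [← map_mul, s.Y_K, map_smul, map_mul]
  H_X := by simp only [← map_mul, ← map_sub, ← map_smul, s.H_X]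
  H_Y := by simp only [← map_mul, ← map_sub, ← map_smul, s.H_Y]
  X_Y := by simp only [← map_mul, ← map_sub, ← map_smul, s.X_Y]

theorem endRep_H (ρ : Uq q →ₐ[𝕜] Module.End 𝕜 M) (m : Module.End 𝕜 M) :
    endRep ρ (gen q .H) m = ρ (gen q .H) * m - m * ρ (gen q .H) := by
  simp [endRep, comul, antipode, lift_gen, comulGen, antipodeGen, sub_eq_add_neg]

theorem endRep_K (ρ : Uq q →ₐ[𝕜] Module.End 𝕜 M) (m : Module.End 𝕜 M) :
    endRep ρ (gen q .K) m = ρ (gen q .K) * m * ρ (gen q .Ki) := by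
  simp [endRep, comul, antipode, lift_gen, comulGen, antipodeGen]

theorem endRep_Ki (ρ : Uq q →ₐ[𝕜] Module.End 𝕜 M) (m : Module.End 𝕜 M) :
    endRep ρ (gen q .Ki) m = ρ (gen q .Ki) * m * ρ (gen q .K) := by
  simp [endRep, comul, antipode, lift_gen, comulGen, antipodeGen]

theorem endRep_X (ρ : Uq q →ₐ[𝕜] Module.End 𝕜 M) (m : Module.End 𝕜 M) :
    endRep ρ (gen q .X) m =
      ρ (gen q .X) * m - ρ (gen q .Ki) * m * (ρ (gen q .K) * ρ (gen q .X)) := by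
  simp [endRep, comul, antipode, lift_gen, comulGen, antipodeGen, sub_eq_add_neg]

theorem endRep_Y (ρ : Uq q →ₐ[𝕜] Module.End 𝕜 M) (m : Module.End 𝕜 M) :
    endRep ρ (gen q .Y) m = (ρ (gen q .Y) * m - m * ρ (gen q .Y)) * ρ (gen q .Ki) := by
  simp [endRep, comul, antipode, lift_gen, comulGen, antipodeGen, sub_eq_add_neg, add_mul,
    mul_assoc, add_comm]

theorem vRep_gen (h0 : q ≠ 0) (h1 : q ^ 2 ≠ 1) (g : Gen) (z : V 𝕜) :
    vRep q h0 h1 (gen q g) z = (vMat q g).mulVec z := by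
  simp [vRep, lift_gen]

/-- The linear map on `V` with prescribed values on the basis `u, v, w`. -/
def ofBasis (a b c : M) : V 𝕜 →ₗ[𝕜] M where
  toFun z := z 0 • a + z 1 • b + z 2 • c
  map_add' x y := by simp only [Pi.add_apply]; module
  map_smul' r x := by simp only [Pi.smul_apply, smul_eq_mul, RingHom.id_apply]; module

theorem ofBasis_apply (a b c : M) (z : V 𝕜) :
    ofBasis a b c z = z 0 • a + z 1 • b + z 2 • c := rfl

theorem V.linearMap_ext {f g : V 𝕜 →ₗ[𝕜] M} (hu : f (u 𝕜) = g (u 𝕜)) (hv : f (v 𝕜) = g (v 𝕜))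
    (hw : f (w 𝕜) = g (w 𝕜)) : f = g := by
  refine LinearMap.ext fun z ↦ ?_
  have hz : z = z 0 • u 𝕜 + z 1 • v 𝕜 + z 2 • w 𝕜 := by
    ext i; fin_cases i <;> simp [u, v, w]
  rw [hz]
  simp only [map_add, map_smul, hu, hv, hw]

end Modules

/-! Algebras in which the Casimir element is a scalar. -/

section Casimir

variable {q : 𝕜} {B : Type*} [Ring B] [Algebra 𝕜 B] {F : Gen → B}

/-- The Casimir element of `U_q(sl(2))` acts as the scalar `c`. -/
def HasCasimir (q c : 𝕜) (F : Gen → B) : Prop :=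
  F .Y * F .X = c • 1 - ((q - q⁻¹)⁻¹ ^ 2) • (q • F .K + q⁻¹ • F .Ki)

/-- The image of `v` under the standard morphism from `V`. -/
def vImage (q c : 𝕜) (F : Gen → B) : B :=
  ((1 - q ^ 2) * c) • 1 + ((q - q⁻¹)⁻¹ ^ 2 * (q ^ 3 - q⁻¹)) • F .K

theorem sub_inv_ne_zero (h0 : q ≠ 0) (h1 : q ^ 2 ≠ 1) : q - q⁻¹ ≠ 0 := by
  intro h
  apply h1
  field_simp at h
  linear_combination h

theorem Satisfies.Ki_Y (s : Satisfies q F) : F .Ki * F .Y = q ^ 2 • (F .Y * F .Ki) := by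
  calc F .Ki * F .Y = F .Ki * (F .Y * F .K) * F .Ki := by
        rw [mul_assoc, mul_assoc, s.K_Ki, mul_one]
    _ = _ := by rw [s.Y_K, mul_smul_comm, ← mul_assoc, s.Ki_K, one_mul, smul_mul_assoc]

theorem Satisfies.X_K (s : Satisfies q F) (h0 : q ≠ 0) :
    F .X * F .K = (q ^ 2)⁻¹ • (F .K * F .X) := by
  rw [s.K_X, smul_smul, inv_mul_cancel₀ (pow_ne_zero 2 h0), one_smul]

theorem Satisfies.K_Y (s : Satisfies q F) (h0 : q ≠ 0) :
    F .K * F .Y = (q ^ 2)⁻¹ • (F .Y * F .K) := by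
  rw [s.Y_K, smul_smul, inv_mul_cancel₀ (pow_ne_zero 2 h0), one_smul]

variable {c : 𝕜}

/-- The commutator `[X, Y]` exchanges the coefficients `q` and `q⁻¹` in the Casimir formula for
`YX`. -/
theorem HasCasimir.X_Y (hc : HasCasimir q c F) (s : Satisfies q F) (h0 : q ≠ 0)
    (h1 : q ^ 2 ≠ 1) :
    F .X * F .Y = c • 1 - ((q - q⁻¹)⁻¹ ^ 2) • (q⁻¹ • F .K + q • F .Ki) := by
  have hd := sub_inv_ne_zero h0 h1
  -- All coefficients are brought to multiples of `(q - q⁻¹)⁻²`, after which the identities are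
  -- polynomial in `q` and `q⁻¹`.
  have hd' : (q - q⁻¹)⁻¹ = (q - q⁻¹)⁻¹ ^ 2 * (q - q⁻¹) := by field_simp
  have h : F .X * F .Y =
      F .Y * F .X + ((q - q⁻¹)⁻¹ ^ 2 * (q - q⁻¹)) • (F .K - F .Ki) := by
    rw [← hd', ← s.X_Y]; abel
  rw [h, hc]
  match_scalars <;> ring

theorem HasCasimir.X_Y_sub (hc : HasCasimir q c F) (s : Satisfies q F) (h0 : q ≠ 0)
    (h1 : q ^ 2 ≠ 1) : F .X * F .Y - q ^ 2 • (F .Y * F .X) = vImage q c F := by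
  rw [hc.X_Y s h0 h1, hc, vImage]
  match_scalars
  · ring
  · ring
  · field_simp; ring

theorem K_vImage (q c : 𝕜) (F : Gen → B) : F .K * vImage q c F = vImage q c F * F .K := by
  simp [vImage, mul_add, add_mul]

/-- As `v` is affine in `K`, the first and third relations reduce to q-commuting `K` past `X` and
`Y`: the terms in `K` cancel and the constant term of `v` gives the factor. In the second, `YK =
q²KY` turns the commutator into `Kv`, so that `v` can be factored out of the left side. -/
theorem relations_image (s : Satisfies q F) (hc : HasCasimir q c F) (h0 : q ≠ 0)
    (h1 : q ^ 2 ≠ 1) {h ν : 𝕜} (hν : 2 * h * ν = (q ^ 2 - 1) ^ 2 * c) :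
    Relations q h ν (F .K * F .X) (vImage q c F) (F .Y) := by
  have hd := sub_inv_ne_zero h0 h1
  have h2 : q ^ 2 - 1 ≠ 0 := sub_ne_zero.mpr h1
  refine ⟨?_, ?_, ?_⟩
  · have e : ν • (-2 * h) • (F .K * F .X) = (-(q ^ 2 - 1) ^ 2 * c) • (F .K * F .X) := by
      rw [smul_smul]; congr 1; linear_combination -hν
    rw [e]
    simp only [vImage, mul_add, add_mul, mul_smul_comm, smul_mul_assoc, mul_one, one_mul,
      mul_assoc, s.X_K h0]
    match_scalars
    · ring
    · field_simp; ring
  · have e : ν • (2 * h) • vImage q c F = ((q ^ 2 - 1) ^ 2 * c) • vImage q c F := by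
      rw [smul_smul]; congr 1; linear_combination hν
    have e1 : F .K * F .X * F .Y - F .Y * (F .K * F .X) = F .K * vImage q c F := by
      rw [← hc.X_Y_sub s h0 h1, mul_sub, ← mul_assoc (F .Y), s.Y_K]
      simp only [mul_smul_comm, smul_mul_assoc, mul_assoc]
    rw [e, e1, ← smul_mul_assoc, ← smul_mul_assoc, ← add_mul]
    -- The coefficient `(q³ - q⁻¹)/(q - q⁻¹)²` of `K` in `v` is exactly the one that makes `K` drop
    -- out here.
    have e2 : (q ^ 3 + q) • F .K + (1 - q ^ 2) • vImage q c F
        = ((q ^ 2 - 1) ^ 2 * c) • (1 : B) := by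
      rw [vImage]
      match_scalars
      · have : q - q⁻¹ = (q ^ 2 - 1) / q := by field_simp
        rw [this]; field_simp; ring
      · ring
    rw [e2, smul_mul_assoc, one_mul]
  · have e : ν • (2 * h) • F .Y = ((q ^ 2 - 1) ^ 2 * c) • F .Y := by
      rw [smul_smul]; congr 1; linear_combination hν
    rw [e]
    simp only [vImage, mul_add, add_mul, mul_smul_comm, smul_mul_assoc, mul_one, one_mul,
      s.Y_K]
    match_scalars
    · ring
    · ring

/-- The left sides are homogeneous of degree two, the right sides of degree one. -/
theorem Relations.smul {h ν : 𝕜} {x y z : B} (r : Relations q h ν x y z) (s : 𝕜) :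
    Relations q h (s * ν) (s • x) (s • y) (s • z) := by
  obtain ⟨r1, r2, r3⟩ := r
  have key : ∀ r : 𝕜, ∀ m : B, (s * ν) • r • s • m = (s * s) • ν • r • m := by
    intro r m; module
  refine ⟨?_, ?_, ?_⟩
  · rw [key, ← r1]; simp only [smul_mul_smul_comm]; module
  · rw [key, ← r2]; simp only [smul_mul_smul_comm]; module
  · rw [key, ← r3]; simp only [smul_mul_smul_comm]; module

end Casimir

/-! ### The standard morphism from `V` to `End(U)` -/

section StandardMorphism

variable {q c : 𝕜} {U : Type*} [AddCommGroup U] [Module 𝕜 U]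

/-- The standard morphism from `V` to the endomorphisms of a module with Casimir scalar `c`. -/
def stdMor (c : 𝕜) (ρ : Uq q →ₐ[𝕜] Module.End 𝕜 U) : V 𝕜 →ₗ[𝕜] Module.End 𝕜 U :=
  ofBasis (ρ (gen q .K) * ρ (gen q .X)) (vImage q c fun x ↦ ρ (gen q x)) (ρ (gen q .Y))

theorem stdMor_u (ρ : Uq q →ₐ[𝕜] Module.End 𝕜 U) :
    stdMor c ρ (u 𝕜) = ρ (gen q .K) * ρ (gen q .X) := by
  simp [stdMor, ofBasis_apply, u]

theorem stdMor_v (ρ : Uq q →ₐ[𝕜] Module.End 𝕜 U) :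
    stdMor c ρ (v 𝕜) = vImage q c fun x ↦ ρ (gen q x) := by
  simp [stdMor, ofBasis_apply, v]

theorem stdMor_w (ρ : Uq q →ₐ[𝕜] Module.End 𝕜 U) : stdMor c ρ (w 𝕜) = ρ (gen q .Y) := by
  simp [stdMor, ofBasis_apply, w]

/-- The scalar Casimir gives the image of `v` two descriptions. As `XY - q²YX` it yields `X·w = v`
and `Y·u = -v`; as an affine function of `K` it yields `X·v` and `Y·v`, and shows that `v` has
weight 0. -/
theorem intertwines_stdMor (h0 : q ≠ 0) (h1 : q ^ 2 ≠ 1) {ρ : Uq q →ₐ[𝕜] Module.End 𝕜 U}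
    (hc : HasCasimir q c fun x ↦ ρ (gen q x)) :
    Intertwines (vRep q h0 h1) (endRep ρ) (stdMor c ρ) := by
  have hd := sub_inv_ne_zero h0 h1
  have h2 : q ^ 2 - 1 ≠ 0 := sub_ne_zero.mpr h1
  have hdq : q - q⁻¹ = (q ^ 2 - 1) / q := by field_simp
  have s := (satisfies_gen q).map ρ
  have hXY := hc.X_Y_sub s h0 h1
  have hKv := K_vImage q c fun x ↦ ρ (gen q x)
  have hvdef : vImage q c (fun x ↦ ρ (gen q x)) = ((1 - q ^ 2) * c) • 1 +
    ((q - q⁻¹)⁻¹ ^ 2 * (q ^ 3 - q⁻¹)) • ρ (gen q .K) := rfl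
  have sK := s.K_Ki
  have sKi := s.Ki_K
  have sHK := s.H_K
  have sKX := s.K_X
  have sXK := s.X_K h0
  have sKY := s.K_Y h0
  have sYK := s.Y_K
  have sKiY := s.Ki_Y
  have sHX := sub_eq_iff_eq_add.mp s.H_X
  have sHY := sub_eq_iff_eq_add.mp s.H_Y
  apply intertwines_of_gen
  intro g z
  rw [vRep_gen, stdMor, ofBasis_apply, ofBasis_apply, map_add, map_add, map_smul, map_smul,
    map_smul]
  -- The image of `v` becomes opaque, so that `hXY` and `hvdef` are applied only where wanted.
  generalize vImage q c (fun x ↦ ρ (gen q x)) = b at *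
  cases g
  · rw [endRep_H, endRep_H, endRep_H]
    have e1 : ρ (gen q .H) * (ρ (gen q .K) * ρ (gen q .X)) -
        ρ (gen q .K) * ρ (gen q .X) * ρ (gen q .H) = (2 : 𝕜) • (ρ (gen q .K) * ρ (gen q .X)) := by
      rw [← mul_assoc, sHK, mul_assoc, sHX, mul_add, ← mul_assoc, mul_smul_comm]; abel
    have e2 : ρ (gen q .H) * b - b * ρ (gen q .H) = 0 := by
      rw [hvdef]; simp [mul_add, add_mul, sHK]
    rw [e1, e2, s.H_Y]
    simp [vMat, Matrix.mulVec, dotProduct, Fin.sum_univ_three]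
    module
  · rw [endRep_X, endRep_X, endRep_X]
    have e1 : ρ (gen q .X) * (ρ (gen q .K) * ρ (gen q .X)) - ρ (gen q .Ki) *
        (ρ (gen q .K) * ρ (gen q .X)) * (ρ (gen q .K) * ρ (gen q .X)) = 0 := by
      rw [← mul_assoc (ρ (gen q .Ki)), sKi, one_mul, sub_self]
    have e2 : ρ (gen q .X) * b - ρ (gen q .Ki) * b * (ρ (gen q .K) * ρ (gen q .X)) =
        -(q + q⁻¹) • (ρ (gen q .K) * ρ (gen q .X)) := by
      rw [mul_assoc, ← mul_assoc b, ← hKv, mul_assoc, ← mul_assoc, sKi, one_mul, hvdef]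
      simp only [mul_add, add_mul, mul_smul_comm, smul_mul_assoc, mul_one, one_mul, sXK]
      match_scalars
      · ring
      · rw [hdq]; field_simp; ring
    have e3 : ρ (gen q .X) * ρ (gen q .Y) - ρ (gen q .Ki) * ρ (gen q .Y) *
        (ρ (gen q .K) * ρ (gen q .X)) = b := by
      rw [sKiY, smul_mul_assoc, mul_assoc, ← mul_assoc (ρ (gen q .Ki)), sKi, one_mul, hXY]
    rw [e1, e2, e3]
    simp [vMat, Matrix.mulVec, dotProduct, Fin.sum_univ_three]
    module
  · rw [endRep_Y, endRep_Y, endRep_Y]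
    have e1 : (ρ (gen q .Y) * (ρ (gen q .K) * ρ (gen q .X)) -
        ρ (gen q .K) * ρ (gen q .X) * ρ (gen q .Y)) * ρ (gen q .Ki) = -b := by
      rw [← mul_assoc, sYK, smul_mul_assoc, mul_assoc, mul_assoc, ← mul_smul_comm, ← mul_sub,
        ← neg_sub, hXY, mul_neg, neg_mul, hKv, mul_assoc, sK, mul_one]
    have e2 : (ρ (gen q .Y) * b - b * ρ (gen q .Y)) * ρ (gen q .Ki) =
        (q + q⁻¹) • ρ (gen q .Y) := by
      have e : ρ (gen q .Y) * b - b * ρ (gen q .Y) =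
          (q + q⁻¹) • (ρ (gen q .Y) * ρ (gen q .K)) := by
        rw [hvdef]
        simp only [mul_add, add_mul, mul_smul_comm, smul_mul_assoc, mul_one, one_mul, sKY]
        match_scalars
        · ring
        · rw [hdq]; field_simp; ring
      rw [e, smul_mul_assoc, mul_assoc, sK, mul_one]
    rw [e1, e2, sub_self, zero_mul]
    simp [vMat, Matrix.mulVec, dotProduct, Fin.sum_univ_three]
    module
  · rw [endRep_K, endRep_K, endRep_K]
    have e1 : ρ (gen q .K) * (ρ (gen q .K) * ρ (gen q .X)) * ρ (gen q .Ki) =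
        q ^ 2 • (ρ (gen q .K) * ρ (gen q .X)) := by
      rw [mul_assoc, sKX, smul_mul_assoc, mul_assoc, sK, mul_one, mul_smul_comm, ← sKX]
    have e2 : ρ (gen q .K) * b * ρ (gen q .Ki) = b := by
      rw [hKv, mul_assoc, sK, mul_one]
    have e3 : ρ (gen q .K) * ρ (gen q .Y) * ρ (gen q .Ki) = (q ^ 2)⁻¹ • ρ (gen q .Y) := by
      rw [sKY, smul_mul_assoc, mul_assoc, sK, mul_one]
    rw [e1, e2, e3]
    simp [vMat, Matrix.mulVec, dotProduct, Fin.sum_univ_three]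
    module
  · rw [endRep_Ki, endRep_Ki, endRep_Ki]
    have e1 : ρ (gen q .Ki) * (ρ (gen q .K) * ρ (gen q .X)) * ρ (gen q .K) =
        (q ^ 2)⁻¹ • (ρ (gen q .K) * ρ (gen q .X)) := by
      rw [← mul_assoc, sKi, one_mul, sXK]
    have e2 : ρ (gen q .Ki) * b * ρ (gen q .K) = b := by
      rw [mul_assoc, ← hKv, ← mul_assoc, sKi, one_mul]
    have e3 : ρ (gen q .Ki) * ρ (gen q .Y) * ρ (gen q .K) = q ^ 2 • ρ (gen q .Y) := by
      rw [sKiY, smul_mul_assoc, mul_assoc, sKi, mul_one]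
    rw [e1, e2, e3]
    simp [vMat, Matrix.mulVec, dotProduct, Fin.sum_univ_three]
    module

end StandardMorphism

/-- The eigenvalue of `q^H` on the `i`-th vector below a highest weight vector of weight `l`. -/
def kVal (q : 𝕜) (l i : ℕ) : 𝕜 := q ^ l * (q ^ 2)⁻¹ ^ i

/-- The scalar by which the Casimir element acts on a module of highest weight `l`. -/
def casimir (q : 𝕜) (l : ℕ) : 𝕜 := (q - q⁻¹)⁻¹ ^ 2 * (q * q ^ l + q⁻¹ * (q ^ l)⁻¹)

/-- The coefficient of `X` from the `(i + 1)`-st weight vector to the `i`-th one. -/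
def xCoef (q : 𝕜) (l i : ℕ) : 𝕜 :=
  casimir q l - (q - q⁻¹)⁻¹ ^ 2 * (q⁻¹ * kVal q l i + q * (kVal q l i)⁻¹)

/-! ### Vanishing and nonvanishing of the ladder coefficients and of the Casimir scalar -/

section Scalars

variable {q : 𝕜} {l : ℕ}

theorem kVal_ne_zero (h0 : q ≠ 0) (i : ℕ) : kVal q l i ≠ 0 := by
  unfold kVal; positivity

theorem kVal_succ (i : ℕ) : kVal q l (i + 1) = kVal q l i * (q ^ 2)⁻¹ := by
  unfold kVal; ring

/-- The factored form makes the zeros visible: the coefficient vanishes at `i = l`, and for generic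
`q` at no smaller index. -/
theorem xCoef_eq (h0 : q ≠ 0) (i : ℕ) :
    xCoef q l i = (q - q⁻¹)⁻¹ ^ 2 *
      ((q ^ (2 * (i + 1)) - 1) * (q ^ (2 * l) - q ^ (2 * i)) / (q ^ (2 * i + 1) * q ^ l)) := by
  unfold xCoef casimir kVal
  rw [← mul_sub]
  congr 1
  rw [inv_pow]
  field_simp
  ring

theorem xCoef_self (h0 : q ≠ 0) : xCoef q l l = 0 := by
  rw [xCoef_eq h0]; simp

theorem xCoef_ne_zero (h0 : q ≠ 0) (h1 : q ^ 2 ≠ 1)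
    (hq : ∀ n : ℕ, 1 ≤ n → n ≤ l → q ^ (2 * n) ≠ 1) {i : ℕ} (hi : i < l) :
    xCoef q l i ≠ 0 := by
  have hd := sub_inv_ne_zero h0 h1
  have e1 : q ^ (2 * (i + 1)) - 1 ≠ 0 := sub_ne_zero.mpr (hq _ (by omega) (by omega))
  have e2 : q ^ (2 * l) - q ^ (2 * i) ≠ 0 := by
    have e3 : q ^ (2 * l) - q ^ (2 * i) = q ^ (2 * i) * (q ^ (2 * (l - i)) - 1) := by
      rw [mul_sub, ← pow_add, mul_one]; congr 2; omega
    rw [e3]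
    exact mul_ne_zero (pow_ne_zero _ h0) (sub_ne_zero.mpr (hq _ (by omega) (by omega)))
  rw [xCoef_eq h0]
  exact mul_ne_zero (pow_ne_zero _ (inv_ne_zero hd)) (div_ne_zero (mul_ne_zero e1 e2)
    (mul_ne_zero (pow_ne_zero _ h0) (pow_ne_zero _ h0)))

/-- Vanishing would mean `q ^ (2l + 2) = -1`, whose square is excluded by the last case `n = 2l + 2`
of genericity. -/
theorem casimir_ne_zero (h0 : q ≠ 0) (h1 : q ^ 2 ≠ 1)
    (hq : q ^ (2 * (2 * l + 2)) ≠ 1) : casimir q l ≠ 0 := by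
  have hd := sub_inv_ne_zero h0 h1
  refine mul_ne_zero (pow_ne_zero _ (inv_ne_zero hd)) fun h ↦ hq ?_
  have h2 : q ^ (2 * l + 2) = -1 := by
    have : q * q ^ l + q⁻¹ * (q ^ l)⁻¹ = (q ^ (2 * l + 2) + 1) / (q * q ^ l) := by
      field_simp; ring
    rw [this, div_eq_zero_iff] at h
    rcases h with h | h
    · exact eq_neg_of_add_eq_zero_left h
    · exact absurd h (by positivity)
  rw [mul_comm, pow_mul, h2]; ring

end Scalars

/-- The vectors `e i` form the ladder below a highest weight vector of weight `l`. -/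
structure IsLadder {q : 𝕜} {U : Type*} [AddCommGroup U] [Module 𝕜 U] (l : ℕ)
    (ρ : Uq q →ₐ[𝕜] Module.End 𝕜 U) (e : ℕ → U) : Prop where
  H_apply : ∀ i, ρ (gen q .H) (e i) = ((l : 𝕜) - 2 * i) • e i
  K_apply : ∀ i, ρ (gen q .K) (e i) = kVal q l i • e i
  Ki_apply : ∀ i, ρ (gen q .Ki) (e i) = (kVal q l i)⁻¹ • e i
  Y_apply : ∀ i, ρ (gen q .Y) (e i) = e (i + 1)
  X_zero : ρ (gen q .X) (e 0) = 0
  X_succ : ∀ i, ρ (gen q .X) (e (i + 1)) = xCoef q l i • e i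

/-! ### The ladder below a highest weight vector -/

section Ladder

variable {q : 𝕜} {l : ℕ} {U : Type*} [AddCommGroup U] [Module 𝕜 U]
  {ρ : Uq q →ₐ[𝕜] Module.End 𝕜 U}

theorem end_ext_of_span {e : ℕ → U} (hs : Submodule.span 𝕜 (Set.range e) = ⊤) (hz : ∀ i, e (l + 1 + i) = 0)
    {f g : Module.End 𝕜 U} (hfg : ∀ i ≤ l, f (e i) = g (e i)) : f = g := by
  apply LinearMap.ext_on_range hs
  intro i
  rcases Nat.lt_or_ge l i with hi | hi
  · obtain ⟨j, rfl⟩ := Nat.exists_eq_add_of_le (Nat.succ_le_of_lt hi)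
    rw [Nat.succ_eq_add_one, hz, map_zero, map_zero]
  · exact hfg i hi

/-- Only the formula for `X` needs an argument: moving `X` past `Y` adds a multiple of `K - K⁻¹`,
which is the difference of two consecutive values of `xCoef`. -/
theorem isLadder_of_highest (h0 : q ≠ 0) (h1 : q ^ 2 ≠ 1) {x : U}
    (hX : ρ (gen q .X) x = 0) (hH : ρ (gen q .H) x = (l : 𝕜) • x)
    (hK : ρ (gen q .K) x = q ^ l • x) :
    IsLadder l ρ fun i ↦ (ρ (gen q .Y) ^ i) x := by
  have s := (satisfies_gen q).map ρ
  have hd := sub_inv_ne_zero h0 h1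
  have hY : ∀ i, (ρ (gen q .Y) ^ (i + 1)) x = ρ (gen q .Y) ((ρ (gen q .Y) ^ i) x) := by
    intro i; rw [pow_succ']; rfl
  have HK : ∀ i, ρ (gen q .K) ((ρ (gen q .Y) ^ i) x) = kVal q l i • (ρ (gen q .Y) ^ i) x := by
    intro i
    induction i with
    | zero => simpa [kVal] using hK
    | succ i ih =>
      have e := LinearMap.congr_fun (s.K_Y h0) ((ρ (gen q .Y) ^ i) x)
      simp only [Module.End.mul_apply, LinearMap.smul_apply] at e
      rw [hY, e, ih, map_smul, smul_smul, kVal_succ, mul_comm]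
  have HKi : ∀ i, ρ (gen q .Ki) ((ρ (gen q .Y) ^ i) x) =
      (kVal q l i)⁻¹ • (ρ (gen q .Y) ^ i) x := by
    intro i
    have e := LinearMap.congr_fun s.Ki_K ((ρ (gen q .Y) ^ i) x)
    simp only [Module.End.mul_apply, Module.End.one_apply] at e
    rw [HK, map_smul] at e
    rw [eq_inv_smul_iff₀ (kVal_ne_zero h0 i), e]
  have HH : ∀ i : ℕ, ρ (gen q .H) ((ρ (gen q .Y) ^ i) x) =
      ((l : 𝕜) - 2 * i) • (ρ (gen q .Y) ^ i) x := by
    intro i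
    induction i with
    | zero => simpa using hH
    | succ i ih =>
      have e := LinearMap.congr_fun s.H_Y ((ρ (gen q .Y) ^ i) x)
      simp only [Module.End.mul_apply, LinearMap.smul_apply, LinearMap.sub_apply] at e
      rw [sub_eq_iff_eq_add, ih, map_smul, ← hY] at e
      rw [e]
      push_cast
      module
  refine ⟨HH, HK, HKi, fun i ↦ (hY i).symm, by simpa using hX, fun i ↦ ?_⟩
  have hd' : (q - q⁻¹)⁻¹ = (q - q⁻¹)⁻¹ ^ 2 * (q - q⁻¹) := by field_simp
  have e : ∀ y, ρ (gen q .X) (ρ (gen q .Y) y) = ρ (gen q .Y) (ρ (gen q .X) y) +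
      ((q - q⁻¹)⁻¹ ^ 2 * (q - q⁻¹)) • (ρ (gen q .K) y - ρ (gen q .Ki) y) := by
    intro y
    have e := LinearMap.congr_fun s.X_Y y
    simp only [Module.End.mul_apply, LinearMap.smul_apply, LinearMap.sub_apply] at e
    rw [← hd', ← e]; abel
  induction i with
  | zero =>
    rw [hY, e, HK, HKi]
    simp only [pow_zero, Module.End.one_apply, hX, map_zero, zero_add, ← sub_smul, smul_smul]
    congr 1
    simp only [xCoef, casimir, kVal, pow_zero, mul_one]
    ring
  | succ i ih =>
    rw [hY (i + 1), e, ih, map_smul, ← hY, HK, HKi]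
    simp only [← sub_smul, smul_smul, ← add_smul]
    congr 1
    have hk := kVal_ne_zero (l := l) h0 i
    simp only [xCoef, kVal_succ, mul_inv, inv_inv]
    generalize kVal q l i = k at *
    field_simp
    ring

namespace IsLadder

variable {e : ℕ → U} (L : IsLadder l ρ e)
include L

theorem span_invariant (a : Uq q) :
    ∀ y ∈ Submodule.span 𝕜 (Set.range e), ρ a y ∈ Submodule.span 𝕜 (Set.range e) := by
  have he : ∀ i, e i ∈ Submodule.span 𝕜 (Set.range e) := fun i ↦ Submodule.subset_span ⟨i, rfl⟩
  refine invariant_of_gen (fun g y hy ↦ ?_) a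
  induction hy using Submodule.span_induction with
  | zero => simp
  | add y z _ _ hy hz => rw [map_add]; exact Submodule.add_mem _ hy hz
  | smul r y _ hy => rw [map_smul]; exact Submodule.smul_mem _ _ hy
  | mem y hy =>
    obtain ⟨i, rfl⟩ := hy
    cases g
    · rw [L.H_apply]; exact Submodule.smul_mem _ _ (he _)
    · cases i
      · rw [L.X_zero]; exact Submodule.zero_mem _
      · rw [L.X_succ]; exact Submodule.smul_mem _ _ (he _)
    · rw [L.Y_apply]; exact he _
    · rw [L.K_apply]; exact Submodule.smul_mem _ _ (he _)
    · rw [L.Ki_apply]; exact Submodule.smul_mem _ _ (he _)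

/-- `X` cannot climb out of the tail because `xCoef q l l = 0`. This submodule misses the highest
weight vector, so irreducibility makes it zero. -/
theorem tail_invariant (h0 : q ≠ 0) (a : Uq q) :
    ∀ y ∈ Submodule.span 𝕜 (Set.range fun i ↦ e (l + 1 + i)),
      ρ a y ∈ Submodule.span 𝕜 (Set.range fun i ↦ e (l + 1 + i)) := by
  have he : ∀ i, e (l + 1 + i) ∈ Submodule.span 𝕜 (Set.range fun i ↦ e (l + 1 + i)) :=
    fun i ↦ Submodule.subset_span ⟨i, rfl⟩
  refine invariant_of_gen (fun g y hy ↦ ?_) a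
  induction hy using Submodule.span_induction with
  | zero => simp
  | add y z _ _ hy hz => rw [map_add]; exact Submodule.add_mem _ hy hz
  | smul r y _ hy => rw [map_smul]; exact Submodule.smul_mem _ _ hy
  | mem y hy =>
    obtain ⟨i, rfl⟩ := hy
    dsimp only
    cases g
    · rw [L.H_apply]; exact Submodule.smul_mem _ _ (he _)
    · cases i with
      | zero => rw [add_zero, L.X_succ, xCoef_self h0, zero_smul]; exact Submodule.zero_mem _
      | succ i => rw [← add_assoc, L.X_succ]; exact Submodule.smul_mem _ _ (he _)
    · rw [L.Y_apply]; exact he (i + 1)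
    · rw [L.K_apply]; exact Submodule.smul_mem _ _ (he _)
    · rw [L.Ki_apply]; exact Submodule.smul_mem _ _ (he _)

theorem span_eq_top (hirr : IsIrreducible ρ) (h : e 0 ≠ 0) :
    Submodule.span 𝕜 (Set.range e) = ⊤ := by
  refine (hirr.2 _ L.span_invariant).resolve_left fun hb ↦ h ?_
  rw [← Submodule.mem_bot 𝕜, ← hb]
  exact Submodule.subset_span ⟨0, rfl⟩

/-- The span of the ladder vectors beyond the `l`-th one contains no vector of weight `l`. -/
theorem eq_zero_of_tail [CharZero 𝕜] {y : U}
    (hy : y ∈ Submodule.span 𝕜 (Set.range fun i ↦ e (l + 1 + i)))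
    (hH : ρ (gen q .H) y = (l : 𝕜) • y) : y = 0 := by
  set T := ρ (gen q .H)
  have h1 : Submodule.span 𝕜 (Set.range fun i ↦ e (l + 1 + i)) ≤
      ⨆ μ ≠ (l : 𝕜), T.eigenspace μ := by
    rw [Submodule.span_le]
    rintro _ ⟨i, rfl⟩
    refine Submodule.mem_iSup_of_mem ((l : 𝕜) - 2 * (l + 1 + i : ℕ)) ?_
    refine Submodule.mem_iSup_of_mem ?_ ?_
    · intro h
      have : (2 : 𝕜) * (l + 1 + i : ℕ) = 0 := by linear_combination -h
      norm_cast at this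
      omega
    · rw [Module.End.mem_eigenspace_iff]
      exact L.H_apply _
  have h2 := (Module.End.eigenspaces_iSupIndep T) (l : 𝕜)
  exact (Submodule.disjoint_def.mp h2) y (Module.End.mem_eigenspace_iff.mpr hH) (h1 hy)

theorem eq_zero_of_gt [CharZero 𝕜] (h0 : q ≠ 0) (hirr : IsIrreducible ρ) (h : e 0 ≠ 0)
    (i : ℕ) : e (l + 1 + i) = 0 := by
  have hb := (hirr.2 _ (L.tail_invariant h0)).resolve_right fun ht ↦ h
    (L.eq_zero_of_tail (ht ▸ Submodule.mem_top) (by simpa using L.H_apply 0))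
  rw [← Submodule.mem_bot 𝕜, ← hb]
  exact Submodule.subset_span ⟨i, rfl⟩

theorem ne_zero (h : e 0 ≠ 0) (hx : ∀ i < l, xCoef q l i ≠ 0) (i : ℕ) (hi : i ≤ l) :
    e i ≠ 0 := by
  induction i with
  | zero => exact h
  | succ i ih =>
    intro hz
    have := L.X_succ i
    rw [hz, map_zero, eq_comm, smul_eq_zero] at this
    exact this.elim (hx i (by omega)) (ih (by omega))

theorem linearIndependent [CharZero 𝕜] (h : e 0 ≠ 0) (hx : ∀ i < l, xCoef q l i ≠ 0) :
    LinearIndependent 𝕜 fun i : Fin (l + 1) ↦ e i := by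
  refine Module.End.eigenvectors_linearIndependent' (ρ (gen q .H))
    (fun i : Fin (l + 1) ↦ (l : 𝕜) - 2 * (i : ℕ)) ?_ _ ?_
  · intro i j hij
    simp only [sub_right_inj, mul_eq_mul_left_iff, Nat.cast_inj, OfNat.ofNat_ne_zero,
      or_false] at hij
    exact Fin.ext hij
  · intro i
    exact ⟨Module.End.mem_eigenspace_iff.mpr (L.H_apply i), L.ne_zero h hx i (by omega)⟩

/-- On a ladder vector `YX` is a scalar, and `K` changes by `q⁻²` per step, which matches `xCoef` at
the previous index. -/
theorem hasCasimir (h0 : q ≠ 0) (hs : Submodule.span 𝕜 (Set.range e) = ⊤) :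
    HasCasimir q (casimir q l) fun x ↦ ρ (gen q x) := by
  unfold HasCasimir
  apply LinearMap.ext_on_range hs
  intro i
  simp only [Module.End.mul_apply, LinearMap.sub_apply, LinearMap.smul_apply,
    LinearMap.add_apply, Module.End.one_apply, L.K_apply, L.Ki_apply, smul_smul, ← sub_smul,
    ← add_smul]
  cases i with
  | zero =>
    rw [L.X_zero, map_zero, eq_comm]
    convert zero_smul 𝕜 (e 0)
    simp [casimir, kVal]
  | succ i =>
    rw [L.X_succ, map_smul, L.Y_apply]
    congr 1
    have hk := kVal_ne_zero (l := l) h0 i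
    simp only [xCoef, kVal_succ, mul_inv, inv_inv]
    field_simp

/-- Each weight space is spanned by the corresponding ladder vector. -/
theorem exists_smul_of_weight [CharZero 𝕜] (hs : Submodule.span 𝕜 (Set.range e) = ⊤)
    {j : ℕ} {y : U} (hy : ρ (gen q .H) y = ((l : 𝕜) - 2 * j) • y) :
    ∃ s : 𝕜, y = s • e j := by
  set T := ρ (gen q .H)
  -- The ladder spans, and each vector other than `e j` has a different weight; independence of the
  -- eigenspaces then removes the second component of `y`.
  have hmem : y ∈ Submodule.span 𝕜 {e j} ⊔ ⨆ μ ≠ (l : 𝕜) - 2 * j, T.eigenspace μ := by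
    have : (⊤ : Submodule 𝕜 U) ≤
        Submodule.span 𝕜 {e j} ⊔ ⨆ μ ≠ (l : 𝕜) - 2 * j, T.eigenspace μ := by
      rw [← hs, Submodule.span_le]
      rintro _ ⟨i, rfl⟩
      by_cases hij : i = j
      · subst hij
        exact Submodule.mem_sup_left (Submodule.mem_span_singleton_self _)
      · refine Submodule.mem_sup_right (Submodule.mem_iSup_of_mem ((l : 𝕜) - 2 * i)
          (Submodule.mem_iSup_of_mem ?_ (Module.End.mem_eigenspace_iff.mpr (L.H_apply i))))
        simpa using hij
    exact this Submodule.mem_top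
  obtain ⟨y1, hy1, y2, hy2, rfl⟩ := Submodule.mem_sup.mp hmem
  obtain ⟨s, rfl⟩ := Submodule.mem_span_singleton.mp hy1
  have hd := (Module.End.eigenspaces_iSupIndep T) ((l : 𝕜) - 2 * j)
  have h2 : y2 ∈ T.eigenspace ((l : 𝕜) - 2 * j) := by
    have := sub_mem (Module.End.mem_eigenspace_iff.mpr hy)
      (Submodule.smul_mem _ s (Module.End.mem_eigenspace_iff.mpr (L.H_apply j)))
    simpa using this
  refine ⟨s, ?_⟩
  rw [Submodule.disjoint_def.mp hd y2 h2 hy2, add_zero]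

end IsLadder

end Ladder

/-! ### Morphisms from `V` to `End(U)` -/

section Classification

variable {q : 𝕜} {l : ℕ} {U : Type*} [AddCommGroup U] [Module 𝕜 U]
  {ρ : Uq q →ₐ[𝕜] Module.End 𝕜 U}

/-- The vector `u` generates `V` under `Y`, because `q + q⁻¹` is invertible. -/
theorem intertwines_ext (h0 : q ≠ 0) (h1 : q ^ 2 ≠ 1) (h2 : q + q⁻¹ ≠ 0)
    {f g : V 𝕜 →ₗ[𝕜] Module.End 𝕜 U} (hf : Intertwines (vRep q h0 h1) (endRep ρ) f)
    (hg : Intertwines (vRep q h0 h1) (endRep ρ) g) (hu : f (u 𝕜) = g (u 𝕜)) : f = g := by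
  have eu : vRep q h0 h1 (gen q .Y) (u 𝕜) = -v 𝕜 := by
    rw [vRep_gen]; ext i; fin_cases i <;>
      simp [vMat, u, v, Matrix.mulVec, dotProduct, Fin.sum_univ_three]
  have ev : vRep q h0 h1 (gen q .Y) (v 𝕜) = (q + q⁻¹) • w 𝕜 := by
    rw [vRep_gen]; ext i; fin_cases i <;>
      simp [vMat, v, w, Matrix.mulVec, dotProduct, Fin.sum_univ_three]
  have hv : f (v 𝕜) = g (v 𝕜) := by
    have e := hf (gen q .Y) (u 𝕜)
    rw [hu, ← hg, eu, map_neg, map_neg, neg_inj] at e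
    exact e
  refine V.linearMap_ext hu hv ?_
  have e := hf (gen q .Y) (v 𝕜)
  rw [hv, ← hg, ev, map_smul, map_smul] at e
  exact smul_right_injective _ h2 e

theorem IsLadder.exists_eq_smul_stdMor [CharZero 𝕜] {e : ℕ → U} (L : IsLadder l ρ e)
    (hl : 1 ≤ l) (h0 : q ≠ 0) (h1 : q ^ 2 ≠ 1) (h2 : q + q⁻¹ ≠ 0)
    (hx : ∀ i < l, xCoef q l i ≠ 0) (hs : Submodule.span 𝕜 (Set.range e) = ⊤)
    (hz : ∀ i, e (l + 1 + i) = 0) {f : V 𝕜 →ₗ[𝕜] Module.End 𝕜 U}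
    (hf : Intertwines (vRep q h0 h1) (endRep ρ) f) :
    ∃ s : 𝕜, f = s • stdMor (casimir q l) ρ := by
  have s := (satisfies_gen q).map ρ
  have sKi := s.Ki_K
  have hst := intertwines_stdMor h0 h1 (L.hasCasimir h0 hs)
  have eH : vRep q h0 h1 (gen q .H) (u 𝕜) = (2 : 𝕜) • u 𝕜 := by
    rw [vRep_gen]; ext i; fin_cases i <;>
      simp [vMat, u, Matrix.mulVec, dotProduct, Fin.sum_univ_three]
  have eX : vRep q h0 h1 (gen q .X) (u 𝕜) = 0 := by
    rw [vRep_gen]; ext i; fin_cases i <;>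
      simp [vMat, u, Matrix.mulVec, dotProduct, Fin.sum_univ_three]
  have eK : vRep q h0 h1 (gen q .K) (u 𝕜) = q ^ 2 • u 𝕜 := by
    rw [vRep_gen]; ext i; fin_cases i <;>
      simp [vMat, u, Matrix.mulVec, dotProduct, Fin.sum_univ_three]
  obtain ⟨m, rfl⟩ : ∃ m, l = m + 1 := ⟨l - 1, by omega⟩
  -- The lowest vector has weight `-l`; its image under `f u` has weight `2 - l`, that of `e m`.
  have weight : ρ (gen q .H) (f (u 𝕜) (e (m + 1))) =
      (((m + 1 : ℕ) : 𝕜) - 2 * m) • f (u 𝕜) (e (m + 1)) := by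
    have e1 := hf (gen q .H) (u 𝕜)
    rw [eH, map_smul, endRep_H] at e1
    have e2 := LinearMap.congr_fun e1 (e (m + 1))
    simp only [LinearMap.smul_apply, LinearMap.sub_apply, Module.End.mul_apply, L.H_apply,
      map_smul] at e2
    rw [eq_sub_iff_add_eq] at e2
    rw [← e2]
    push_cast
    module
  obtain ⟨r, hr⟩ := L.exists_smul_of_weight hs weight
  have hk := kVal_ne_zero (l := m + 1) h0 m
  have hxm := hx m (by omega)
  -- The denominator is the coefficient of `KX` from `e (m + 1)` to `e m`, so the difference `g` has
  -- `g u` killing the lowest vector.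
  refine ⟨r / (xCoef q (m + 1) m * kVal q (m + 1) m), ?_⟩
  set c := r / (xCoef q (m + 1) m * kVal q (m + 1) m)
  set g := f - c • stdMor (casimir q (m + 1)) ρ with hgdef
  have hg : Intertwines (vRep q h0 h1) (endRep ρ) g := by
    intro a x
    have := hst.smul c a x
    rw [hgdef, LinearMap.sub_apply, hf a x, this, LinearMap.sub_apply, map_sub]
  suffices hgu : g (u 𝕜) = 0 by
    have : g = 0 := intertwines_ext h0 h1 h2 hg (fun a x ↦ by simp) (by simpa using hgu)
    exact sub_eq_zero.mp this
  -- From `X·u = 0` and the `K`-weight of `u`, `X` and `g u` commute up to `q⁻²`; hence the kernel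
  -- of `g u` is stable under `X`.
  have hcomm : ∀ y, g (u 𝕜) y = 0 → g (u 𝕜) (ρ (gen q .X) y) = 0 := by
    intro y hy
    have e1 := hg (gen q .X) (u 𝕜)
    have e3 := hg (gen q .K) (u 𝕜)
    rw [eX, map_zero, endRep_X, eq_comm, sub_eq_zero] at e1
    rw [eK, map_smul, endRep_K] at e3
    have e4 : ρ (gen q .Ki) * g (u 𝕜) * ρ (gen q .K) = (q ^ 2)⁻¹ • g (u 𝕜) := by
      rw [eq_inv_smul_iff₀ (pow_ne_zero 2 h0), ← smul_mul_assoc, ← mul_smul_comm, e3]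
      simp only [mul_assoc, sKi, mul_one]
      rw [← mul_assoc, sKi, one_mul]
    rw [← mul_assoc, e4] at e1
    have e2 := LinearMap.congr_fun e1 y
    simp only [Module.End.mul_apply, hy, map_zero, LinearMap.smul_apply] at e2
    exact (smul_eq_zero.mp e2.symm).resolve_left (inv_ne_zero (pow_ne_zero 2 h0))
  have hlow : g (u 𝕜) (e (m + 1)) = 0 := by
    rw [hgdef, LinearMap.sub_apply, LinearMap.sub_apply, hr, LinearMap.smul_apply, stdMor_u,
      LinearMap.smul_apply, Module.End.mul_apply, L.X_succ, map_smul, L.K_apply, smul_smul,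
      smul_smul, mul_assoc, div_mul_cancel₀ r (mul_ne_zero hxm hk), sub_self]
  -- Here `i` counts the applications of `X` to the lowest vector.
  have hall : ∀ i j, i + j = m + 1 → g (u 𝕜) (e j) = 0 := by
    intro i
    induction i with
    | zero => intro j hj; rw [zero_add] at hj; rw [hj, hlow]
    | succ i ih =>
      intro j hj
      have e1 := hcomm _ (ih (j + 1) (by omega))
      rw [L.X_succ, map_smul] at e1
      exact (smul_eq_zero.mp e1).resolve_left (hx j (by omega))
  exact end_ext_of_span hs hz fun i hi ↦ by rw [hall (m + 1 - i) i (by omega)]; rfl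

/-- On `e 0` the image of `u` vanishes while those of `v` and `w` give independent vectors; `e 1`
then detects `u`. Both exist because `l ≥ 1`. -/
theorem IsLadder.stdMor_injective [CharZero 𝕜] {e : ℕ → U} (L : IsLadder l ρ e) (hl : 1 ≤ l)
    (h0 : q ≠ 0) (h1 : q ^ 2 ≠ 1) (hx : ∀ i < l, xCoef q l i ≠ 0) (he : e 0 ≠ 0)
    (hs : Submodule.span 𝕜 (Set.range e) = ⊤) :
    Function.Injective (stdMor (casimir q l) ρ) := by
  have hc := L.hasCasimir h0 hs
  have s := (satisfies_gen q).map ρ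
  rw [← LinearMap.ker_eq_bot, LinearMap.ker_eq_bot']
  intro z hz
  rw [stdMor, ofBasis_apply, ← hc.X_Y_sub s h0 h1] at hz
  have hind := L.linearIndependent he hx
  have e0 := LinearMap.congr_fun hz (e 0)
  simp only [LinearMap.add_apply, LinearMap.smul_apply, LinearMap.sub_apply,
    Module.End.mul_apply, L.X_zero, map_zero, L.Y_apply, L.X_succ, smul_zero, zero_add, sub_zero,
    LinearMap.zero_apply, smul_smul] at e0
  have hp : LinearIndependent 𝕜 ![e 0, e 1] := by
    have h := hind.comp (![⟨0, by omega⟩, ⟨1, by omega⟩] : Fin 2 → Fin (l + 1)) (by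
      intro i j; fin_cases i <;> fin_cases j <;> simp)
    convert h using 1
    ext i; fin_cases i <;> rfl
  obtain ⟨z1, z2⟩ := LinearIndependent.pair_iff.mp hp _ _ e0
  have z1' : z 1 = 0 := (mul_eq_zero.mp z1).resolve_right (hx 0 (by omega))
  have e1 := LinearMap.congr_fun hz (e 1)
  simp only [z1', z2, zero_smul, add_zero, LinearMap.smul_apply, Module.End.mul_apply,
    L.X_succ 0, map_smul, L.K_apply, LinearMap.zero_apply, smul_smul, smul_eq_zero,
    mul_eq_zero, hx 0 (by omega), kVal_ne_zero h0, he, or_false] at e1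
  ext i
  fin_cases i
  · exact e1
  · exact z1'
  · exact z2

end Classification

/-! Construction of the irreducible module of spin `l / 2`. -/

section Existence

/-- Extension of a vector by zero. -/
def extend {l : ℕ} (y : Fin (l + 1) → 𝕜) (i : ℕ) : 𝕜 := if h : i < l + 1 then y ⟨i, h⟩ else 0

/-- The generators of `U_q(sl(2))` acting on coordinates with respect to a ladder. -/
def spinGen (q : 𝕜) (l : ℕ) : Gen → Module.End 𝕜 (Fin (l + 1) → 𝕜)
  | .H =>
    { toFun := fun y i ↦ ((l : 𝕜) - 2 * (i : ℕ)) * y i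
      map_add' := fun x y ↦ by ext i; simp [mul_add]
      map_smul' := fun r y ↦ by ext i; simp [mul_left_comm] }
  | .X =>
    { toFun := fun y i ↦ xCoef q l i * extend y (i + 1)
      map_add' := fun x y ↦ by ext i; simp only [extend, Pi.add_apply]; split_ifs <;> ring
      map_smul' := fun r y ↦ by
        ext i; simp only [extend, Pi.smul_apply, smul_eq_mul, RingHom.id_apply]
        split_ifs <;> ring }
  | .Y =>
    -- The case `i = 0` is separate because truncated subtraction would give `0 - 1 = 0`.
    { toFun := fun y i ↦ if (i : ℕ) = 0 then 0 else extend y (i - 1)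
      map_add' := fun x y ↦ by ext i; simp only [extend, Pi.add_apply]; split_ifs <;> ring
      map_smul' := fun r y ↦ by
        ext i; simp only [extend, Pi.smul_apply, smul_eq_mul, RingHom.id_apply]
        split_ifs <;> ring }
  | .K =>
    { toFun := fun y i ↦ kVal q l i * y i
      map_add' := fun x y ↦ by ext i; simp [mul_add]
      map_smul' := fun r y ↦ by ext i; simp [mul_left_comm] }
  | .Ki =>
    { toFun := fun y i ↦ (kVal q l i)⁻¹ * y i
      map_add' := fun x y ↦ by ext i; simp [mul_add]
      map_smul' := fun r y ↦ by ext i; simp [mul_left_comm] }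

variable {q : 𝕜} {l : ℕ}

theorem spinGen_H (y : Fin (l + 1) → 𝕜) (i : Fin (l + 1)) :
    spinGen q l .H y i = ((l : 𝕜) - 2 * (i : ℕ)) * y i := rfl

theorem spinGen_X (y : Fin (l + 1) → 𝕜) (i : Fin (l + 1)) :
    spinGen q l .X y i = xCoef q l i * extend y (i + 1) := rfl

theorem spinGen_Y (y : Fin (l + 1) → 𝕜) (i : Fin (l + 1)) :
    spinGen q l .Y y i = if (i : ℕ) = 0 then 0 else extend y (i - 1) := rfl

theorem spinGen_K (y : Fin (l + 1) → 𝕜) (i : Fin (l + 1)) :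
    spinGen q l .K y i = kVal q l i * y i := rfl

theorem spinGen_Ki (y : Fin (l + 1) → 𝕜) (i : Fin (l + 1)) :
    spinGen q l .Ki y i = (kVal q l i)⁻¹ * y i := rfl

theorem extend_of_lt (y : Fin (l + 1) → 𝕜) {i : ℕ} (h : i < l + 1) : extend y i = y ⟨i, h⟩ := by
  simp [extend, h]

theorem extend_of_not_lt (y : Fin (l + 1) → 𝕜) {i : ℕ} (h : ¬ i < l + 1) :
    extend y i = 0 := by
  simp [extend, h]

theorem spinGen_XY (h0 : q ≠ 0) (y : Fin (l + 1) → 𝕜) (i : Fin (l + 1)) :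
    spinGen q l .X (spinGen q l .Y y) i = xCoef q l i * y i := by
  rw [spinGen_X]
  by_cases h : (i : ℕ) + 1 < l + 1
  · rw [extend_of_lt _ h, spinGen_Y]
    rw [if_neg (by simp)]
    simp only [Nat.add_sub_cancel]
    rw [extend_of_lt _ i.isLt]
  · have : (i : ℕ) = l := by omega
    rw [this, xCoef_self h0, zero_mul, zero_mul]

theorem spinGen_YX (y : Fin (l + 1) → 𝕜) (i : Fin (l + 1)) :
    spinGen q l .Y (spinGen q l .X y) i =
      (casimir q l - (q - q⁻¹)⁻¹ ^ 2 * (q * kVal q l i + q⁻¹ * (kVal q l i)⁻¹)) * y i := by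
  rw [spinGen_Y]
  obtain ⟨i, hi⟩ := i
  cases i with
  | zero => simp [casimir, kVal]
  | succ i =>
    rw [if_neg (by simp), extend_of_lt _ (by simp; omega), spinGen_X]
    simp only [Nat.add_sub_cancel]
    rw [extend_of_lt _ hi]
    congr 1
    -- For `q = 0` the convention `0⁻¹ = 0` makes both coefficients zero.
    by_cases h0 : q = 0
    · simp [xCoef, casimir, h0]
    have hk := kVal_ne_zero (l := l) h0 i
    simp only [xCoef, kVal_succ, mul_inv, inv_inv]
    field_simp

theorem satisfies_spinGen (h0 : q ≠ 0) (h1 : q ^ 2 ≠ 1) : Satisfies q (spinGen q l) := by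
  have hd := sub_inv_ne_zero h0 h1
  have hk : ∀ i, kVal q l i ≠ 0 := fun i ↦ kVal_ne_zero h0 i
  constructor <;> refine LinearMap.ext fun y ↦ funext fun i ↦ ?_ <;>
    simp only [Module.End.mul_apply, LinearMap.smul_apply, LinearMap.sub_apply, Pi.smul_apply,
      Pi.sub_apply, Module.End.one_apply, smul_eq_mul]
  · rw [spinGen_K, spinGen_Ki, mul_inv_cancel_left₀ (hk _)]
  · rw [spinGen_Ki, spinGen_K, inv_mul_cancel_left₀ (hk _)]
  · rw [spinGen_K, spinGen_H, spinGen_H, spinGen_K]; ring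
  · rw [spinGen_K, spinGen_X, spinGen_X]
    by_cases h : (i : ℕ) + 1 < l + 1
    · rw [extend_of_lt _ h, extend_of_lt _ h, spinGen_K, kVal_succ]
      field_simp
    · rw [extend_of_not_lt _ h, extend_of_not_lt _ h]; ring
  · rw [spinGen_K, spinGen_Y, spinGen_Y]
    obtain ⟨i, hi⟩ := i
    cases i with
    | zero => simp
    | succ i =>
      rw [if_neg (by simp), if_neg (by simp)]
      simp only [Nat.add_sub_cancel]
      rw [extend_of_lt _ (by omega), extend_of_lt _ (by omega), spinGen_K, kVal_succ]
      field_simp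
  · rw [spinGen_H, spinGen_X, spinGen_X]
    by_cases h : (i : ℕ) + 1 < l + 1
    · rw [extend_of_lt _ h, extend_of_lt _ h, spinGen_H]
      push_cast
      ring
    · rw [extend_of_not_lt _ h, extend_of_not_lt _ h]; ring
  · rw [spinGen_H, spinGen_Y, spinGen_Y]
    obtain ⟨i, hi⟩ := i
    cases i with
    | zero => simp
    | succ i =>
      rw [if_neg (by simp), if_neg (by simp)]
      simp only [Nat.add_sub_cancel]
      rw [extend_of_lt _ (by omega), extend_of_lt _ (by omega), spinGen_H]
      push_cast
      ring
  · rw [spinGen_XY h0, spinGen_YX, spinGen_K, spinGen_Ki, xCoef]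
    have := hk i
    field_simp
    ring

/-- The module of spin `l / 2`. -/
noncomputable def spinRep (l : ℕ) (h0 : q ≠ 0) (h1 : q ^ 2 ≠ 1) :
    Uq q →ₐ[𝕜] Module.End 𝕜 (Fin (l + 1) → 𝕜) :=
  lift q (spinGen q l) (satisfies_spinGen h0 h1)

theorem spinGen_Y_single {i : ℕ} (hi : i + 1 < l + 1) :
    spinGen q l .Y (Pi.single ⟨i, by omega⟩ 1) = Pi.single ⟨i + 1, hi⟩ 1 := by
  funext j
  rw [spinGen_Y]
  obtain ⟨j, hj⟩ := j
  cases j with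
  | zero => simp
  | succ j =>
    rw [if_neg (by simp)]
    simp only [Nat.add_sub_cancel]
    rw [extend_of_lt _ (by omega)]
    simp [Pi.single_apply]

/-- `X` lowers the top index of the support by one without killing the leading coefficient, so
repeated application reaches a nonzero multiple of the highest weight vector. The induction is on a
bound for that index. -/
theorem single_zero_mem {W : Submodule 𝕜 (Fin (l + 1) → 𝕜)}
    (hW : ∀ y ∈ W, spinGen q l .X y ∈ W) (hx : ∀ i < l, xCoef q l i ≠ 0) (n : ℕ) :
    ∀ y ∈ W, y ≠ 0 → (∀ i : Fin (l + 1), n < i → y i = 0) →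
      (Pi.single 0 1 : Fin (l + 1) → 𝕜) ∈ W := by
  induction n with
  | zero =>
    intro y hy hne hsupp
    have e : y = y 0 • (Pi.single 0 1 : Fin (l + 1) → 𝕜) := by
      funext i
      by_cases hi : i = 0
      · subst hi; simp
      · rw [hsupp i (Nat.pos_of_ne_zero fun h ↦ hi (Fin.ext h))]; simp [hi]
    have hy0 : y 0 ≠ 0 := fun h ↦ hne (by rw [e, h, zero_smul])
    rw [e] at hy
    exact (W.smul_mem_iff hy0).mp hy
  | succ n ih =>
    intro y hy hne hsupp
    by_cases hn : n + 1 < l + 1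
    · by_cases hz : y ⟨n + 1, hn⟩ = 0
      · refine ih y hy hne fun i hi ↦ ?_
        rcases Nat.lt_or_ge (n + 1) i with h | h
        · exact hsupp i h
        · have : i = ⟨n + 1, hn⟩ := Fin.ext (by simp; omega)
          rw [this, hz]
      · refine ih _ (hW y hy) (fun h ↦ hz ?_) fun i hi ↦ ?_
        · have e := congr_fun h ⟨n, by omega⟩
          rw [spinGen_X, extend_of_lt _ hn] at e
          exact (mul_eq_zero.mp e).resolve_left (hx n (by omega))
        · rw [spinGen_X]
          by_cases h : (i : ℕ) + 1 < l + 1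
          · rw [extend_of_lt _ h, hsupp _ (by simp; omega), mul_zero]
          · rw [extend_of_not_lt _ h, mul_zero]
    · exact ih y hy hne fun i hi ↦ absurd i.isLt (by omega)

theorem isSpin_spinRep (h0 : q ≠ 0) (h1 : q ^ 2 ≠ 1) (hx : ∀ i < l, xCoef q l i ≠ 0) :
    IsSpin q l (spinRep l h0 h1) := by
  refine ⟨⟨inferInstance, fun W hW ↦ ?_⟩, Pi.single 0 1, ?_, ?_, ?_, ?_⟩
  · rw [or_iff_not_imp_left]
    intro hne
    obtain ⟨y, hy, hy0⟩ := W.ne_bot_iff.mp hne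
    have hg : ∀ g, ∀ y ∈ W, spinGen q l g y ∈ W := by
      intro g y hy
      have := hW (gen q g) y hy
      rwa [spinRep, lift_gen] at this
    have h := single_zero_mem (hg .X) hx l y hy hy0 fun i hi ↦ absurd i.isLt (by omega)
    have hall : ∀ i (hi : i < l + 1), (Pi.single ⟨i, hi⟩ 1 : Fin (l + 1) → 𝕜) ∈ W := by
      intro i
      induction i with
      | zero => intro hi; exact h
      | succ i ih =>
        intro hi
        rw [← spinGen_Y_single (q := q) hi]
        exact hg .Y _ (ih _)
    rw [eq_top_iff, ← (Pi.basisFun 𝕜 (Fin (l + 1))).span_eq, Submodule.span_le]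
    rintro _ ⟨i, rfl⟩
    rw [Pi.basisFun_apply]
    exact hall i i.isLt
  · simp
  · rw [spinRep, lift_gen]
    funext i
    rw [spinGen_X]
    by_cases h : (i : ℕ) + 1 < l + 1
    · have hne : (⟨i + 1, h⟩ : Fin (l + 1)) ≠ 0 := fun h' ↦ Nat.succ_ne_zero _ (congrArg Fin.val h')
      rw [extend_of_lt _ h, Pi.single_eq_of_ne hne, mul_zero]
      rfl
    · rw [extend_of_not_lt _ h]; simp
  · rw [spinRep, lift_gen]
    funext i
    rw [spinGen_H]
    by_cases h : i = 0
    · subst h; simp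
    · simp [h]
  · rw [spinRep, lift_gen]
    funext i
    rw [spinGen_K]
    by_cases h : i = 0
    · subst h; simp [kVal]
    · simp [h]

end Existence

/-! The universal property of `A_{h,q}`. -/

section Enveloping

variable {B : Type*} [Ring B] [Algebra 𝕜 B]

theorem existsUnique_lift_Ahq {h q : 𝕜} (f : V 𝕜 →ₗ[𝕜] B)
    (hf : Relations q h 1 (f (u 𝕜)) (f (v 𝕜)) (f (w 𝕜))) :
    ∃! φ : Ahq h q →ₐ[𝕜] B, ∀ z : V 𝕜, φ (ιA h q z) = f z := by
  obtain ⟨r1, r2, r3⟩ := hf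
  have hrel : ∀ ⦃x y⦄, ARel h q x y → TensorAlgebra.lift 𝕜 f x = TensorAlgebra.lift 𝕜 f y := by
    intro x y hxy
    rw [one_smul] at r1 r2 r3
    cases hxy <;>
      simp only [map_add, map_sub, map_smul, map_mul, TensorAlgebra.lift_ι_apply]
    · exact r1
    · exact r2
    · exact r3
  refine ⟨RingQuot.liftAlgHom 𝕜 ⟨TensorAlgebra.lift 𝕜 f, hrel⟩, fun z ↦ ?_, fun φ hφ ↦ ?_⟩
  · exact (RingQuot.liftAlgHom_mkAlgHom_apply 𝕜 _ _ _).trans (TensorAlgebra.lift_ι_apply _ _)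
  · apply RingQuot.ringQuot_ext'
    apply TensorAlgebra.hom_ext
    ext1 z
    refine LinearMap.ext fun c ↦ ?_
    exact (hφ _).trans (((RingQuot.liftAlgHom_mkAlgHom_apply 𝕜 _ _ _).trans
      (TensorAlgebra.lift_ι_apply _ _)).symm)

end Enveloping

end QSl2

/-! ### Multiplicity one and the normalisation of the factor -/

theorem proposition1 {𝕜 : Type*} [RCLike 𝕜] (q h : 𝕜) (hh : h ≠ 0) (l : ℕ) (hl : 1 ≤ l)
    (h0 : q ≠ 0) (h1 : q ^ 2 ≠ 1)
    (hq : ∀ n : ℕ, 1 ≤ n → n ≤ 2 * l + 2 → q ^ (2 * n) ≠ 1) :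
    (∃ ρ : QSl2.Uq q →ₐ[𝕜] Module.End 𝕜 (Fin (l + 1) → 𝕜), QSl2.IsSpin q l ρ) ∧
    ∀ (U : Type*) [AddCommGroup U] [Module 𝕜 U] (ρ : QSl2.Uq q →ₐ[𝕜] Module.End 𝕜 U),
      QSl2.IsSpin q l ρ →
      ∃ W : Submodule 𝕜 (Module.End 𝕜 U),
        (∀ W' : Submodule 𝕜 (Module.End 𝕜 U),
          QSl2.IsCopy (QSl2.vRep q h0 h1) (QSl2.endRep ρ) W' ↔ W' = W) ∧
        ∀ f : QSl2.V 𝕜 →ₗ[𝕜] Module.End 𝕜 U,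
          QSl2.Intertwines (QSl2.vRep q h0 h1) (QSl2.endRep ρ) f →
          LinearMap.range f = W →
          QSl2.IsAlmostRep h0 h1 h ρ f ∧
          ∀ ν : 𝕜, QSl2.IsAlmostRepWith h0 h1 h ν ρ f →
            QSl2.IsRep h0 h1 h ρ (ν⁻¹ • f) ∧
            ∃! φ : QSl2.Ahq h q →ₐ[𝕜] Module.End 𝕜 U,
              ∀ z : QSl2.V 𝕜, φ (QSl2.ιA h q z) = ν⁻¹ • f z := by
  have hx : ∀ i < l, QSl2.xCoef q l i ≠ 0 := fun i hi ↦
    QSl2.xCoef_ne_zero h0 h1 (fun n h1 h2 ↦ hq n h1 (by omega)) hi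
  refine ⟨⟨_, QSl2.isSpin_spinRep h0 h1 hx⟩, ?_⟩
  rintro U _ _ ρ ⟨hirr, x, hx0, hX, hH, hK⟩
  have L := QSl2.isLadder_of_highest h0 h1 hX hH hK
  set e : ℕ → U := fun i ↦ (ρ (QSl2.gen q .Y) ^ i) x
  have he : e 0 ≠ 0 := by simpa [e] using hx0
  have hs := L.span_eq_top hirr he
  have hz := L.eq_zero_of_gt h0 hirr he
  have hc := L.hasCasimir h0 hs
  have hst := QSl2.intertwines_stdMor h0 h1 hc
  have hinj := L.stdMor_injective hl h0 h1 hx he hs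
  have hcas := QSl2.casimir_ne_zero h0 h1 (hq (2 * l + 2) (by omega) le_rfl)
  -- Otherwise `q² = -1`, hence `q⁴ = 1`, which is the excluded case `n = 2`.
  have hq2 : q + q⁻¹ ≠ 0 := by
    intro hzero
    field_simp at hzero
    apply hq 2 (by omega) (by omega)
    linear_combination (q ^ 2 - 1) * hzero
  set f₀ := QSl2.stdMor (QSl2.casimir q l) ρ
  have hclass := fun f hf ↦
    L.exists_eq_smul_stdMor hl h0 h1 hq2 hx hs hz (f := f) hf
  have hu : QSl2.u 𝕜 ≠ 0 := fun h ↦ by simpa [QSl2.u] using congr_fun h 0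
  have hrange : ∀ s : 𝕜, s ≠ 0 → LinearMap.range (s • f₀) = LinearMap.range f₀ :=
    fun s hs ↦ LinearMap.range_smul _ _ hs
  refine ⟨LinearMap.range f₀, fun W' ↦ ⟨?_, ?_⟩, ?_⟩
  · rintro ⟨f, hf, hfi, rfl⟩
    obtain ⟨s, rfl⟩ := hclass f hf
    refine hrange s ?_
    rintro rfl
    exact hu (hfi (by simp))
  · rintro rfl
    exact ⟨f₀, hst, hinj, rfl⟩
  intro f hf hfr
  obtain ⟨s, rfl⟩ := hclass f hf
  have hs0 : s ≠ 0 := by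
    rintro rfl
    rw [zero_smul, LinearMap.range_zero, eq_comm, LinearMap.range_eq_bot] at hfr
    exact hu (hinj (by rw [hfr]; simp))
  -- The factor of the standard morphism solves `2hν = (q² - 1)²c`; scaling by `s` multiplies it by
  -- `s`.
  refine ⟨⟨s * ((q ^ 2 - 1) ^ 2 * QSl2.casimir q l / (2 * h)), hf, ?_, ?_⟩, ?_⟩
  · exact mul_ne_zero hs0 (div_ne_zero
      (mul_ne_zero (pow_ne_zero 2 (sub_ne_zero.mpr h1)) hcas) (mul_ne_zero two_ne_zero hh))
  · have r := QSl2.relations_image ((QSl2.satisfies_gen q).map ρ) hc h0 h1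
      (mul_div_cancel₀ ((q ^ 2 - 1) ^ 2 * QSl2.casimir q l)
        (mul_ne_zero two_ne_zero hh) : 2 * h * _ = _)
    have r' := r.smul s
    simpa only [LinearMap.smul_apply, f₀, QSl2.stdMor_u, QSl2.stdMor_v, QSl2.stdMor_w] using r'
  · rintro ν ⟨-, hν, hr⟩
    have hr' := hr.smul ν⁻¹
    rw [inv_mul_cancel₀ hν] at hr'
    exact ⟨⟨hf.smul _, one_ne_zero, hr'⟩, QSl2.existsUnique_lift_Ahq (ν⁻¹ • s • f₀) hr'⟩
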